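/- Let $n\ge 4$, $\Bbbk=\mathbb{Q}(q)$, and let $\epsilon=(\epsilon_1,\dots,\epsilon_n)\in\{0,1\}^n$ have $M$ entries $0$ and $N$ entries $1$, with $M,N\neq 0$ and $\epsilon_1=0$. Put $\mathbb{I}=\{1,\dots,n\}$, $I=\{0,1,\dots,n-1\}$, and read all subscripts modulo $n$. Let $P=\bigoplus_{j\in\mathbb{I}}\mathbb{Z}\delta_j\oplus\mathbb{Z}\delta\oplus\mathbb{Z}\Lambda_0$ with the symmetric bilinear form $(\delta_i|\delta_j)=(-1)^{\epsilon_i}\delta_{ij}$, $(\Lambda_0|\delta)=1$, all other pairings of basis elements being $0$. Let $\mathbf{q}:P\times P\to\Bbbk^\times$ be the symmetric biadditive function $$\mathbf{q}(\mu,\nu)=q^{ab'+a'b}\prod_{j}q_j^{\mu_j\nu_j}\qquad\Big(\mu=\sum_j\mu_j\delta_j+a\Lambda_0+b\delta,\ \nu=\sum_j\nu_j\delta_j+a'\Lambda_0+b'\delta\Big),$$ where $q_j=q$ if $\epsilon_j=0$ and $q_j=-q^{-1}$ if $\epsilon_j=1$. Put $\alpha_i=\delta_i-\delta_{i+1}+\delta_{i0}\delta$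 and $p(i)=\epsilon_i+\epsilon_{i+1}$ for $i\in I$, $I_{\rm odd}=\{i\in I : (\alpha_i|\alpha_i)=0\}$, $I_{\rm even}=I\setminus I_{\rm odd}$, $[2]=q+q^{-1}$, and $[x,y]_t=xy-t\,yx$. Let $U$ (Yamane's quantum affine superalgebra) be the $\Bbbk$-algebra generated by $K_\mu$ $(\mu\in P)$, $E_i$, $F_i$ $(i\in I)$ with relations, for all $\mu,\nu\in P$ and $i,j\in I$: $K_0=1$; $K_{\mu+\nu}=K_\mu K_\nu$; $K_\mu E_iK_{-\mu}=q^{(\mu|\alpha_i)}E_i$; $K_\mu F_iK_{-\mu}=q^{-(\mu|\alpha_i)}F_i$; $$E_iF_j-(-1)^{p(i)p(j)}F_jE_i=(-1)^{\epsilon_i}\delta_{ij}\frac{K_{\alpha_i}-K_{-\alpha_i}}{q-q^{-1}};$$ and, for $x=E$ and for $x=F$: $x_i^2=0$ $(i\in I_{\rm odd})$; $x_ix_j=(-1)^{p(i)p(j)}x_jx_i$ $(i-j\not\equiv\pm1)$; $x_i^2x_j-[2]x_ix_jx_i+x_jx_i^2=0$ $(i\in I_{\rm even},\ i-j\equiv\pm1)$;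 and for $i\in I_{\rm odd}$ $$\Big[x_i,\big[[x_{i-1},x_i]_{(-1)^{p(i-1)}q},x_{i+1}\big]_{(-1)^{(p(i-1)+p(i))p(i+1)}q^{-1}}\Big]_{(-1)^{p(i-1)+p(i)+p(i+1)}}=0 .$$ Let $\mathcal{U}$ (the generalized quantum group) be the $\Bbbk$-algebra generated by $k_\mu$ $(\mu\in P)$, $e_i$, $f_i$ $(i\in I)$ with relations, for all $\mu,\nu\in P$ and $i,j\in I$: $k_0=1$; $k_{\mu+\nu}=k_\mu k_\nu$; $k_\mu e_ik_{-\mu}=\mathbf{q}(\mu,\alpha_i)e_i$; $k_\mu f_ik_{-\mu}=\mathbf{q}(\mu,\alpha_i)^{-1}f_i$; $e_if_j-f_je_i=\delta_{ij}\frac{k_{\alpha_i}-k_{-\alpha_i}}{q-q^{-1}}$; and, for $x=e$ and for $x=f$: $x_i^2=0$ $(i\in I_{\rm odd})$; $x_ix_j=x_jx_i$ $(i-j\not\equiv\pm1)$; $x_i^2x_j-(-1)^{\epsilon_i}[2]x_ix_jx_i+x_jx_i^2=0$ $(i\in I_{\rm even},\ i-j\equiv\pm1)$; and for $i\in I_{\rm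 odd}$ $$x_ix_{i-1}x_ix_{i+1}-x_ix_{i+1}x_ix_{i-1}+x_{i+1}x_ix_{i-1}x_i-x_{i-1}x_ix_{i+1}x_i+(-1)^{\epsilon_i}[2]x_ix_{i-1}x_{i+1}x_i=0 .$$ The group $(\mathbb{Z}/2)^n$ with generators $\sigma_j$ $(j\in\mathbb{I})$ acts on $U$ and on $\mathcal{U}$ by algebra automorphisms: $\sigma_j$ fixes all $K_\mu$, $k_\mu$ and multiplies $E_i,F_i,e_i,f_i$ by $(-1)^{\epsilon_j(\delta_j|\alpha_i)}$. Let $U[\sigma]$ and $\mathcal{U}[\sigma]$ be the corresponding semidirect products with the group algebra of $(\mathbb{Z}/2)^n$. Put $K_i=K_{\alpha_i}$, $k_i=k_{\alpha_i}$. Let $\mathscr{X}\subset U[\sigma]$ be the subalgebra generated by $E_i,F_i,K_i^{\pm1}$ $(i\in I)$, $K_{\pm\Lambda_0}$, $\sigma_j$ $(j\in\mathbb{I})$, and let $\mathscr{Y}\subset\mathcal{U}[\sigma]$ be the subalgebra generated by $e_i,f_i,k_i^{\pm1}$ $(i\in I)$, $k_{\pm\Lambda_0}$, $\sigma_j$ $(j\in\mathbb{I})$.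 For $i\in I$ let $\bar\imath\in\{1,\dots,n\}$ be its representative modulo $n$ (so $\bar 0=n$), and put $\sigma_{\le i}=\sigma_1\cdots\sigma_{\bar\imath}$, $\varsigma_i=\sigma_i\sigma_{i+1}$; if $\epsilon_i=1$, let $m_i=\bar\imath-a$, where $a$ is the largest element of $\{1,\dots,\bar\imath-1\}$ with $\epsilon_a=0$. Then there is an isomorphism of $\Bbbk$-algebras $\tau:\mathscr{X}\to\mathscr{Y}$ with $\tau(\sigma_j)=\sigma_j$ $(j\in\mathbb{I})$, $\tau(K_{\Lambda_0})=k_{\Lambda_0}$ and, for $i\in I$, according to the value of $(\epsilon_i,\epsilon_{i+1})$: - $(0,0)$: $\tau(E_i)=e_i$, $\tau(F_i)=f_i$, $\tau(K_i)=k_i$; - $(0,1)$: $\tau(E_i)=e_i\sigma_{\le i}$, $\tau(F_i)=f_i\sigma_{\le i}\varsigma_i$, $\tau(K_i)=k_i\varsigma_i$; - $(1,1)$: $\tau(E_i)=e_i\varsigma_i^{m_i}$, $\tau(F_i)=f_i\varsigma_i^{m_i-1}$, $\tau(K_i)=-k_i\varsigma_i$; - $(1,0)$: $\tau(E_i)=e_i\sigma_{\le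 i}\varsigma_i^{m_i}$, $\tau(F_i)=f_i\sigma_{\le i}\varsigma_i^{m_i-1}$, $\tau(K_i)=(-1)^{m_i}k_i\varsigma_i$. Moreover, $\tau$ does not preserve comultiplication: with $\sigma=\sigma_1\cdots\sigma_n$, there are algebra homomorphisms $\Delta:U[\sigma]\to U[\sigma]\otimes U[\sigma]$ and $\Delta:\mathcal{U}[\sigma]\to\mathcal{U}[\sigma]\otimes\mathcal{U}[\sigma]$ for which all $K_\mu$, $k_\mu$, $\sigma_j$ are group-like and $$\Delta(E_i)=\sigma^{p(i)}\otimes E_i+E_i\otimes K_i^{-1},\qquad \Delta(F_i)=F_i\otimes1+K_i\sigma^{p(i)}\otimes F_i,$$ $$\Delta(e_i)=1\otimes e_i+e_i\otimes k_i^{-1},\qquad \Delta(f_i)=f_i\otimes1+k_i\otimes f_i,$$ and the identity $(\tau\otimes\tau)\circ\Delta=\Delta\circ\tau$ on $\mathscr{X}$ fails. -/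

import Mathlib

open scoped TensorProduct

noncomputable section

set_option linter.unusedSectionVars false

namespace QSuper

/-! ### Ground field, index sets, weight lattice

Both `𝕀 = {1 < ⋯ < n}` and `I = {0, …, n-1}` are represented by `ZMod n`, subscripts being read
modulo `n`; the class of `0` is the element `n` of `𝕀`. -/

/-- The ground field `ℚ(q)`. -/
abbrev Kq : Type := RatFunc ℚ

/-- The indeterminate `q`. -/
def q : Kq := RatFunc.X

/-- The quantum integer `[2] = (q² - q⁻²) / (q - q⁻¹)`. -/
def two : Kq := (q ^ 2 - (q⁻¹) ^ 2) / (q - q⁻¹)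

/-- The extended weight lattice `⨁ ℤ δ_j ⊕ ℤ δ ⊕ ℤ Λ₀`: the components of `μ` are the family of
coefficients of the `δ_j`, the coefficient of `δ`, and the coefficient of `Λ₀`. -/
abbrev Wt (n : ℕ) : Type := (ZMod n → ℤ) × ℤ × ℤ

/-- The simple root `α_i = δ_i - δ_{i+1} + δ_{i0} δ`. -/
def root {n : ℕ} (i : ZMod n) : Wt n :=
  (Pi.single i 1 - Pi.single (i + 1) 1, if i = 0 then 1 else 0, 0)

/-- The weight `δ_j`. -/
def del {n : ℕ} (j : ZMod n) : Wt n := (Pi.single j 1, 0, 0)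

/-- The weight `Λ₀`. -/
def Lam (n : ℕ) : Wt n := (0, 0, 1)

variable {n : ℕ} [NeZero n]

/-- The symmetric bilinear form on the extended weight lattice. -/
def form (ε : ZMod n → Fin 2) (μ ν : Wt n) : ℤ :=
  (∑ j, (-1) ^ (ε j : ℕ) * (μ.1 j * ν.1 j)) + (μ.2.2 * ν.2.1 + μ.2.1 * ν.2.2)

/-- `q_j = (-1)^{ε_j} q^{(-1)^{ε_j}}`. -/
def qi (ε : ZMod n → Fin 2) (j : ZMod n) : Kq := if ε j = 0 then q else -q⁻¹

/-- The symmetric biadditive function `𝐪(μ, ν)` on the extended weight lattice. -/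
def bq (ε : ZMod n → Fin 2) (μ ν : Wt n) : Kq :=
  (∏ j, qi ε j ^ (μ.1 j * ν.1 j)) * q ^ (μ.2.2 * ν.2.1 + μ.2.1 * ν.2.2)

/-- `i ∈ I_odd`. -/
def IsOdd (ε : ZMod n → Fin 2) (i : ZMod n) : Prop := form ε (root i) (root i) = 0

/-- `i ∈ I_even`. -/
def IsEven (ε : ZMod n → Fin 2) (i : ZMod n) : Prop :=
  form ε (root i) (root i) = 2 ∨ form ε (root i) (root i) = -2

/-- The parity exponent `p(i) = ε_i + ε_{i+1}`. -/
def par (ε : ZMod n → Fin 2) (i : ZMod n) : ℕ := (ε i : ℕ) + (ε (i + 1) : ℕ)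

/-- The number `M` of zeros of `ε`. -/
def numZero (ε : ZMod n → Fin 2) : ℕ := (Finset.univ.filter fun i => ε i = 0).card

/-- The number `N` of ones of `ε`. -/
def numOne (ε : ZMod n → Fin 2) : ℕ := (Finset.univ.filter fun i => ε i = 1).card

/-! ### The polynomials occurring in the defining relations -/

section Poly

variable {A B : Type*} [Ring A] [Algebra Kq A] [Ring B] [Algebra Kq B]

/-- The bracket `[x, y]_t = x y - t y x`. -/
def qbr (t : Kq) (x y : A) : A := x * y - t • (y * x)

/-- The cubic polynomial `x² y - c x y x + y x²`. -/
def cubic (c : Kq) (x y : A) : A := x ^ 2 * y - c • (x * y * x) + y * x ^ 2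

/-- The quartic polynomial `y x y z - y z y x + z y x y - x y z y + c y x z y`. -/
def quartic (c : Kq) (x y z : A) : A :=
  y * x * y * z - y * z * y * x + z * y * x * y - x * y * z * y + c • (y * x * z * y)

theorem qbr_smul (t a b : Kq) (x y : A) : qbr t (a • x) (b • y) = (a * b) • qbr t x y := by
  simp only [qbr, smul_mul_assoc, mul_smul_comm, smul_sub, smul_smul, mul_comm]

theorem cubic_smul (c a b : Kq) (x y : A) :
    cubic c (a • x) (b • y) = (a * a * b) • cubic c x y := by
  simp only [cubic, pow_two, smul_mul_assoc, mul_smul_comm, smul_sub, smul_add, smul_smul,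
    mul_comm, mul_left_comm, mul_assoc]

theorem quartic_smul (c a b d : Kq) (x y z : A) :
    quartic c (a • x) (b • y) (d • z) = (a * b * b * d) • quartic c x y z := by
  simp only [quartic, smul_mul_assoc, mul_smul_comm, smul_sub, smul_add, smul_smul,
    mul_comm, mul_left_comm, mul_assoc]

theorem map_qbr (φ : A →ₐ[Kq] B) (t : Kq) (x y : A) : φ (qbr t x y) = qbr t (φ x) (φ y) := by
  simp [qbr]

theorem map_cubic (φ : A →ₐ[Kq] B) (c : Kq) (x y : A) :
    φ (cubic c x y) = cubic c (φ x) (φ y) := by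
  simp [cubic]

theorem map_quartic (φ : A →ₐ[Kq] B) (c : Kq) (x y z : A) :
    φ (quartic c x y z) = quartic c (φ x) (φ y) (φ z) := by
  simp [quartic]

end Poly

/-! ### The two algebras -/

/-- The generators of the two algebras. -/
inductive Gen (n : ℕ) : Type
  | K : Wt n → Gen n
  | E : ZMod n → Gen n
  | F : ZMod n → Gen n

/-- The free algebra on the generators. -/
abbrev Fr (n : ℕ) : Type := FreeAlgebra Kq (Gen n)

/-- The generator `K_μ` of the free algebra. -/
def fK (μ : Wt n) : Fr n := FreeAlgebra.ι Kq (Gen.K μ)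

/-- The generator `E_i` of the free algebra. -/
def fE (i : ZMod n) : Fr n := FreeAlgebra.ι Kq (Gen.E i)

/-- The generator `F_i` of the free algebra. -/
def fF (i : ZMod n) : Fr n := FreeAlgebra.ι Kq (Gen.F i)

/-- The left side of the quartic relation at an odd index of the quantum affine superalgebra. -/
def superSerre {A : Type*} [Ring A] [Algebra Kq A] (ε : ZMod n → Fin 2) (i : ZMod n)
    (x y z : A) : A :=
  qbr ((-1) ^ (par ε (i - 1) + par ε i + par ε (i + 1))) y
    (qbr ((-1) ^ ((par ε (i - 1) + par ε i) * par ε (i + 1)) * q⁻¹)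
      (qbr ((-1) ^ par ε (i - 1) * q) x y) z)

/-- Defining relations of the quantum affine superalgebra. -/
inductive SuperRel (ε : ZMod n → Fin 2) : Fr n → Fr n → Prop
  | K_zero : SuperRel ε (fK 0) 1
  | K_add (μ ν : Wt n) : SuperRel ε (fK (μ + ν)) (fK μ * fK ν)
  | K_E (μ : Wt n) (i : ZMod n) :
      SuperRel ε (fK μ * fE i * fK (-μ)) (q ^ form ε μ (root i) • fE i)
  | K_F (μ : Wt n) (i : ZMod n) :
      SuperRel ε (fK μ * fF i * fK (-μ)) (q ^ (-form ε μ (root i)) • fF i)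
  | E_F (i j : ZMod n) :
      SuperRel ε (fE i * fF j - (-1 : Kq) ^ (par ε i * par ε j) • (fF j * fE i))
        (if i = j then ((-1) ^ (ε i : ℕ) / (q - q⁻¹)) • (fK (root i) - fK (-root i)) else 0)
  | E_sq (i : ZMod n) (hi : IsOdd ε i) : SuperRel ε (fE i ^ 2) 0
  | F_sq (i : ZMod n) (hi : IsOdd ε i) : SuperRel ε (fF i ^ 2) 0
  | E_comm (i j : ZMod n) (h1 : i - j ≠ 1) (h2 : i - j ≠ -1) :
      SuperRel ε (qbr ((-1) ^ (par ε i * par ε j)) (fE i) (fE j)) 0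
  | F_comm (i j : ZMod n) (h1 : i - j ≠ 1) (h2 : i - j ≠ -1) :
      SuperRel ε (qbr ((-1) ^ (par ε i * par ε j)) (fF i) (fF j)) 0
  | E_cubic (i j : ZMod n) (hi : IsEven ε i) (h : i - j = 1 ∨ i - j = -1) :
      SuperRel ε (cubic two (fE i) (fE j)) 0
  | F_cubic (i j : ZMod n) (hi : IsEven ε i) (h : i - j = 1 ∨ i - j = -1) :
      SuperRel ε (cubic two (fF i) (fF j)) 0
  | E_quartic (i : ZMod n) (hi : IsOdd ε i) :
      SuperRel ε (superSerre ε i (fE (i - 1)) (fE i) (fE (i + 1))) 0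
  | F_quartic (i : ZMod n) (hi : IsOdd ε i) :
      SuperRel ε (superSerre ε i (fF (i - 1)) (fF i) (fF (i + 1))) 0

/-- Defining relations of the generalized quantum group. -/
inductive GenRel (ε : ZMod n → Fin 2) : Fr n → Fr n → Prop
  | K_zero : GenRel ε (fK 0) 1
  | K_add (μ ν : Wt n) : GenRel ε (fK (μ + ν)) (fK μ * fK ν)
  | K_E (μ : Wt n) (i : ZMod n) :
      GenRel ε (fK μ * fE i * fK (-μ)) (bq ε μ (root i) • fE i)
  | K_F (μ : Wt n) (i : ZMod n) :
      GenRel ε (fK μ * fF i * fK (-μ)) ((bq ε μ (root i))⁻¹ • fF i)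
  | E_F (i j : ZMod n) :
      GenRel ε (fE i * fF j - fF j * fE i)
        (if i = j then (1 / (q - q⁻¹)) • (fK (root i) - fK (-root i)) else 0)
  | E_sq (i : ZMod n) (hi : IsOdd ε i) : GenRel ε (fE i ^ 2) 0
  | F_sq (i : ZMod n) (hi : IsOdd ε i) : GenRel ε (fF i ^ 2) 0
  | E_comm (i j : ZMod n) (h1 : i - j ≠ 1) (h2 : i - j ≠ -1) :
      GenRel ε (qbr 1 (fE i) (fE j)) 0
  | F_comm (i j : ZMod n) (h1 : i - j ≠ 1) (h2 : i - j ≠ -1) :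
      GenRel ε (qbr 1 (fF i) (fF j)) 0
  | E_cubic (i j : ZMod n) (hi : IsEven ε i) (h : i - j = 1 ∨ i - j = -1) :
      GenRel ε (cubic ((-1) ^ (ε i : ℕ) * two) (fE i) (fE j)) 0
  | F_cubic (i j : ZMod n) (hi : IsEven ε i) (h : i - j = 1 ∨ i - j = -1) :
      GenRel ε (cubic ((-1) ^ (ε i : ℕ) * two) (fF i) (fF j)) 0
  | E_quartic (i : ZMod n) (hi : IsOdd ε i) :
      GenRel ε (quartic ((-1) ^ (ε i : ℕ) * two) (fE (i - 1)) (fE i) (fE (i + 1))) 0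
  | F_quartic (i : ZMod n) (hi : IsOdd ε i) :
      GenRel ε (quartic ((-1) ^ (ε i : ℕ) * two) (fF (i - 1)) (fF i) (fF (i + 1))) 0

/-- Yamane's quantum affine superalgebra over the extended weight lattice. -/
def USuper (ε : ZMod n → Fin 2) : Type := RingQuot (SuperRel ε)

instance (ε : ZMod n → Fin 2) : Ring (USuper ε) := inferInstanceAs (Ring (RingQuot (SuperRel ε)))

instance (ε : ZMod n → Fin 2) : Algebra Kq (USuper ε) :=
  inferInstanceAs (Algebra Kq (RingQuot (SuperRel ε)))

/-- The generalized quantum group over the extended weight lattice. -/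
def UGen (ε : ZMod n → Fin 2) : Type := RingQuot (GenRel ε)

instance (ε : ZMod n → Fin 2) : Ring (UGen ε) := inferInstanceAs (Ring (RingQuot (GenRel ε)))

instance (ε : ZMod n → Fin 2) : Algebra Kq (UGen ε) :=
  inferInstanceAs (Algebra Kq (RingQuot (GenRel ε)))

/-- The quotient map onto the quantum affine superalgebra. -/
def mkS (ε : ZMod n → Fin 2) : Fr n →ₐ[Kq] USuper ε := RingQuot.mkAlgHom Kq (SuperRel ε)

/-- The quotient map onto the generalized quantum group. -/
def mkG (ε : ZMod n → Fin 2) : Fr n →ₐ[Kq] UGen ε := RingQuot.mkAlgHom Kq (GenRel ε)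

theorem mkS_rel {ε : ZMod n → Fin 2} {x y : Fr n} (h : SuperRel ε x y) : mkS ε x = mkS ε y :=
  RingQuot.mkAlgHom_rel Kq h

theorem mkG_rel {ε : ZMod n → Fin 2} {x y : Fr n} (h : GenRel ε x y) : mkG ε x = mkG ε y :=
  RingQuot.mkAlgHom_rel Kq h

/-! ### The group of the `σ_j` and its action by signs -/

/-- The group `(ℤ/2)^n` generated by the `σ_j`; its group algebra is the bialgebra `Σ`. -/
abbrev Sig (n : ℕ) : Type := ZMod n → ℤˣ

/-- The generator `σ_j`. -/
def sig (j : ZMod n) : Sig n := Pi.mulSingle j (-1)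

/-- The character of `Sig n` by which it acts on `E_i` and on `F_i`: it sends `σ_j` to
`(-1)^{ε_j (δ_j | α_i)}`. -/
def chi (ε : ZMod n → Fin 2) (i : ZMod n) : Sig n →* ℤˣ where
  toFun g := ∏ j, g j ^ ((ε j : ℕ) * form ε (del j) (root i))
  map_one' := by simp
  map_mul' g h := by simp [mul_zpow, Finset.prod_mul_distrib]

theorem chi_sig (ε : ZMod n → Fin 2) (i j : ZMod n) :
    chi ε i (sig j) = (-1) ^ ((ε j : ℕ) * form ε (del j) (root i)) := by
  change ∏ k, (sig j k) ^ ((ε k : ℕ) * form ε (del k) (root i)) = _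
  rw [Finset.prod_eq_single j]
  · simp [sig]
  · intro k _ hk
    simp [sig, Pi.mulSingle_eq_of_ne hk]
  · simp

/-- The same character with values in the ground field. -/
def chik (ε : ZMod n → Fin 2) (g : Sig n) (i : ZMod n) : Kq := ((chi ε i g : ℤ) : Kq)

theorem chik_one (ε : ZMod n → Fin 2) (i : ZMod n) : chik ε 1 i = 1 := by
  simp [chik]

theorem chik_mul (ε : ZMod n → Fin 2) (g h : Sig n) (i : ZMod n) :
    chik ε (g * h) i = chik ε g i * chik ε h i := by
  simp [chik]

theorem chik_mul_self (ε : ZMod n → Fin 2) (g : Sig n) (i : ZMod n) :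
    chik ε g i * chik ε g i = 1 := by
  rcases Int.units_eq_one_or (chi ε i g) with h | h <;> simp [chik, h]

/-- The action of a group element on the generators. -/
def signGen (ε : ZMod n → Fin 2) (g : Sig n) : Gen n → Fr n
  | Gen.K μ => fK μ
  | Gen.E i => chik ε g i • fE i
  | Gen.F i => chik ε g i • fF i

/-- The action of a group element on the free algebra. -/
def signFr (ε : ZMod n → Fin 2) (g : Sig n) : Fr n →ₐ[Kq] Fr n :=
  FreeAlgebra.lift Kq (signGen ε g)

@[simp] theorem signFr_K (ε : ZMod n → Fin 2) (g : Sig n) (μ : Wt n) :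
    signFr ε g (fK μ) = fK μ := by
  simp only [signFr, fK, FreeAlgebra.lift_ι_apply, signGen]

@[simp] theorem signFr_E (ε : ZMod n → Fin 2) (g : Sig n) (i : ZMod n) :
    signFr ε g (fE i) = chik ε g i • fE i := by
  simp only [signFr, fE, FreeAlgebra.lift_ι_apply, signGen]

@[simp] theorem signFr_F (ε : ZMod n → Fin 2) (g : Sig n) (i : ZMod n) :
    signFr ε g (fF i) = chik ε g i • fF i := by
  simp only [signFr, fF, FreeAlgebra.lift_ι_apply, signGen]

theorem superSerre_smul {A : Type*} [Ring A] [Algebra Kq A] (ε : ZMod n → Fin 2) (i : ZMod n)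
    (a b d : Kq) (x y z : A) :
    superSerre ε i (a • x) (b • y) (d • z) = (b * (a * b * d)) • superSerre ε i x y z := by
  simp only [superSerre, qbr_smul]

theorem map_superSerre {A B : Type*} [Ring A] [Algebra Kq A] [Ring B] [Algebra Kq B]
    (φ : A →ₐ[Kq] B) (ε : ZMod n → Fin 2) (i : ZMod n) (x y z : A) :
    φ (superSerre ε i x y z) = superSerre ε i (φ x) (φ y) (φ z) := by
  simp only [superSerre, map_qbr]

theorem mkS_signFr {ε : ZMod n → Fin 2} (g : Sig n) {x y : Fr n} (h : SuperRel ε x y) :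
    mkS ε (signFr ε g x) = mkS ε (signFr ε g y) := by
  have key := mkS_rel h
  cases h with
  | K_zero => simpa using key
  | K_add μ ν => simpa using key
  | K_E μ i =>
    simp only [map_mul, map_smul, signFr_K, signFr_E, mul_smul_comm, smul_mul_assoc] at key ⊢
    rw [key, smul_comm]
  | K_F μ i =>
    simp only [map_mul, map_smul, signFr_K, signFr_F, mul_smul_comm, smul_mul_assoc] at key ⊢
    rw [key, smul_comm]
  | E_F i j =>
    have e1 : signFr ε g (fE i * fF j - (-1 : Kq) ^ (par ε i * par ε j) • (fF j * fE i)) =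
        (chik ε g i * chik ε g j) •
          (fE i * fF j - (-1 : Kq) ^ (par ε i * par ε j) • (fF j * fE i)) := by
      simp only [map_sub, map_mul, map_smul, signFr_E, signFr_F, mul_smul_comm, smul_mul_assoc,
        smul_sub, smul_smul, mul_comm]
    rw [e1, map_smul, key]
    split_ifs with hij
    · subst hij
      rw [chik_mul_self]
      simp
    · simp
  | E_sq i hi =>
    simp only [pow_two, map_mul, map_smul, signFr_E, mul_smul_comm, smul_mul_assoc, map_zero]
      at key ⊢
    simp [key]
  | F_sq i hi =>
    simp only [pow_two, map_mul, map_smul, signFr_F, mul_smul_comm, smul_mul_assoc, map_zero]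
      at key ⊢
    simp [key]
  | E_comm i j h1 h2 => rw [map_qbr, signFr_E, signFr_E, qbr_smul, map_smul, key]; simp
  | F_comm i j h1 h2 => rw [map_qbr, signFr_F, signFr_F, qbr_smul, map_smul, key]; simp
  | E_cubic i j hi h => rw [map_cubic, signFr_E, signFr_E, cubic_smul, map_smul, key]; simp
  | F_cubic i j hi h => rw [map_cubic, signFr_F, signFr_F, cubic_smul, map_smul, key]; simp
  | E_quartic i hi =>
    rw [map_superSerre, signFr_E, signFr_E, signFr_E, superSerre_smul, map_smul, key]; simp
  | F_quartic i hi =>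
    rw [map_superSerre, signFr_F, signFr_F, signFr_F, superSerre_smul, map_smul, key]; simp

theorem mkG_signFr {ε : ZMod n → Fin 2} (g : Sig n) {x y : Fr n} (h : GenRel ε x y) :
    mkG ε (signFr ε g x) = mkG ε (signFr ε g y) := by
  have key := mkG_rel h
  cases h with
  | K_zero => simpa using key
  | K_add μ ν => simpa using key
  | K_E μ i =>
    simp only [map_mul, map_smul, signFr_K, signFr_E, mul_smul_comm, smul_mul_assoc] at key ⊢
    rw [key, smul_comm]
  | K_F μ i =>
    simp only [map_mul, map_smul, signFr_K, signFr_F, mul_smul_comm, smul_mul_assoc] at key ⊢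
    rw [key, smul_comm]
  | E_F i j =>
    have e1 : signFr ε g (fE i * fF j - fF j * fE i) =
        (chik ε g i * chik ε g j) • (fE i * fF j - fF j * fE i) := by
      simp only [map_sub, map_mul, signFr_E, signFr_F, mul_smul_comm, smul_mul_assoc,
        smul_sub, smul_smul, mul_comm]
    rw [e1, map_smul, key]
    split_ifs with hij
    · subst hij
      rw [chik_mul_self]
      simp
    · simp
  | E_sq i hi =>
    simp only [pow_two, map_mul, map_smul, signFr_E, mul_smul_comm, smul_mul_assoc, map_zero]
      at key ⊢
    simp [key]
  | F_sq i hi =>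
    simp only [pow_two, map_mul, map_smul, signFr_F, mul_smul_comm, smul_mul_assoc, map_zero]
      at key ⊢
    simp [key]
  | E_comm i j h1 h2 => rw [map_qbr, signFr_E, signFr_E, qbr_smul, map_smul, key]; simp
  | F_comm i j h1 h2 => rw [map_qbr, signFr_F, signFr_F, qbr_smul, map_smul, key]; simp
  | E_cubic i j hi h => rw [map_cubic, signFr_E, signFr_E, cubic_smul, map_smul, key]; simp
  | F_cubic i j hi h => rw [map_cubic, signFr_F, signFr_F, cubic_smul, map_smul, key]; simp
  | E_quartic i hi =>
    rw [map_quartic, signFr_E, signFr_E, signFr_E, quartic_smul, map_smul, key]; simp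
  | F_quartic i hi =>
    rw [map_quartic, signFr_F, signFr_F, signFr_F, quartic_smul, map_smul, key]; simp

/-- The action of a group element on the quantum affine superalgebra. -/
def actS (ε : ZMod n → Fin 2) (g : Sig n) : USuper ε →ₐ[Kq] USuper ε :=
  RingQuot.liftAlgHom Kq ⟨(mkS ε).comp (signFr ε g), fun _ _ h => mkS_signFr g h⟩

/-- The action of a group element on the generalized quantum group. -/
def actG (ε : ZMod n → Fin 2) (g : Sig n) : UGen ε →ₐ[Kq] UGen ε :=
  RingQuot.liftAlgHom Kq ⟨(mkG ε).comp (signFr ε g), fun _ _ h => mkG_signFr g h⟩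

theorem actS_mk (ε : ZMod n → Fin 2) (g : Sig n) (x : Fr n) :
    actS ε g (mkS ε x) = mkS ε (signFr ε g x) :=
  RingQuot.liftAlgHom_mkAlgHom_apply Kq ((mkS ε).comp (signFr ε g))
    (fun _ _ h => mkS_signFr g h) x

theorem actG_mk (ε : ZMod n → Fin 2) (g : Sig n) (x : Fr n) :
    actG ε g (mkG ε x) = mkG ε (signFr ε g x) :=
  RingQuot.liftAlgHom_mkAlgHom_apply Kq ((mkG ε).comp (signFr ε g))
    (fun _ _ h => mkG_signFr g h) x

theorem mkS_surjective (ε : ZMod n → Fin 2) : Function.Surjective (mkS ε) :=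
  RingQuot.mkAlgHom_surjective Kq (SuperRel ε)

theorem mkG_surjective (ε : ZMod n → Fin 2) : Function.Surjective (mkG ε) :=
  RingQuot.mkAlgHom_surjective Kq (GenRel ε)

theorem signFr_one (ε : ZMod n → Fin 2) : signFr ε 1 = AlgHom.id Kq (Fr n) := by
  apply FreeAlgebra.hom_ext
  funext x
  cases x with
  | K μ => exact signFr_K ε 1 μ
  | E i => exact (signFr_E ε 1 i).trans (by rw [chik_one, one_smul]; rfl)
  | F i => exact (signFr_F ε 1 i).trans (by rw [chik_one, one_smul]; rfl)

theorem signFr_mul (ε : ZMod n → Fin 2) (g h : Sig n) :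
    signFr ε (g * h) = (signFr ε g).comp (signFr ε h) := by
  apply FreeAlgebra.hom_ext
  funext x
  cases x with
  | K μ =>
    change signFr ε (g * h) (fK μ) = signFr ε g (signFr ε h (fK μ))
    simp
  | E i =>
    change signFr ε (g * h) (fE i) = signFr ε g (signFr ε h (fE i))
    simp [chik_mul, smul_smul, mul_comm]
  | F i =>
    change signFr ε (g * h) (fF i) = signFr ε g (signFr ε h (fF i))
    simp [chik_mul, smul_smul, mul_comm]

/-- `Sig n` acts on the quantum affine superalgebra by algebra automorphisms:
`σ_j K_μ = K_μ`, and `E_i`, `F_i` are multiplied by `(-1)^{ε_j (δ_j | α_i)}`. -/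
instance (ε : ZMod n → Fin 2) : MulSemiringAction (Sig n) (USuper ε) where
  smul g x := actS ε g x
  one_smul x := by
    obtain ⟨y, rfl⟩ := mkS_surjective ε x
    change actS ε 1 (mkS ε y) = _
    rw [actS_mk, signFr_one]
    rfl
  mul_smul g h x := by
    obtain ⟨y, rfl⟩ := mkS_surjective ε x
    change actS ε (g * h) (mkS ε y) = actS ε g (actS ε h (mkS ε y))
    rw [actS_mk, actS_mk, actS_mk, signFr_mul]
    rfl
  smul_zero g := map_zero (actS ε g)
  smul_add g := map_add (actS ε g)
  smul_one g := map_one (actS ε g)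
  smul_mul g := map_mul (actS ε g)

/-- `Sig n` acts on the generalized quantum group by algebra automorphisms, with the same signs. -/
instance (ε : ZMod n → Fin 2) : MulSemiringAction (Sig n) (UGen ε) where
  smul g x := actG ε g x
  one_smul x := by
    obtain ⟨y, rfl⟩ := mkG_surjective ε x
    change actG ε 1 (mkG ε y) = _
    rw [actG_mk, signFr_one]
    rfl
  mul_smul g h x := by
    obtain ⟨y, rfl⟩ := mkG_surjective ε x
    change actG ε (g * h) (mkG ε y) = actG ε g (actG ε h (mkG ε y))
    rw [actG_mk, actG_mk, actG_mk, signFr_mul]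
    rfl
  smul_zero g := map_zero (actG ε g)
  smul_add g := map_add (actG ε g)
  smul_one g := map_one (actG ε g)
  smul_mul g := map_mul (actG ε g)

instance (ε : ZMod n → Fin 2) : SMulCommClass (Sig n) Kq (USuper ε) where
  smul_comm g c x := map_smul (actS ε g) c x

instance (ε : ZMod n → Fin 2) : SMulCommClass (Sig n) Kq (UGen ε) where
  smul_comm g c x := map_smul (actG ε g) c x

/-! ### The semidirect products -/

/-- The semidirect product of the quantum affine superalgebra and the group algebra `Σ`. -/
abbrev USuperSig (ε : ZMod n → Fin 2) : Type := SkewMonoidAlgebra (USuper ε) (Sig n)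

/-- The semidirect product of the generalized quantum group and the group algebra `Σ`. -/
abbrev UGenSig (ε : ZMod n → Fin 2) : Type := SkewMonoidAlgebra (UGen ε) (Sig n)

/-- `E_i` in the extended quantum affine superalgebra. -/
def sE (ε : ZMod n → Fin 2) (i : ZMod n) : USuperSig ε :=
  SkewMonoidAlgebra.single 1 (mkS ε (fE i))

/-- `F_i` in the extended quantum affine superalgebra. -/
def sF (ε : ZMod n → Fin 2) (i : ZMod n) : USuperSig ε :=
  SkewMonoidAlgebra.single 1 (mkS ε (fF i))

/-- `K_μ` in the extended quantum affine superalgebra. -/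
def sK (ε : ZMod n → Fin 2) (μ : Wt n) : USuperSig ε :=
  SkewMonoidAlgebra.single 1 (mkS ε (fK μ))

/-- The elements of the group `Sig n` in the extended quantum affine superalgebra. -/
def sS (ε : ZMod n → Fin 2) : Sig n →* USuperSig ε := SkewMonoidAlgebra.of (USuper ε) (Sig n)

/-- `e_i` in the extended generalized quantum group. -/
def gE (ε : ZMod n → Fin 2) (i : ZMod n) : UGenSig ε :=
  SkewMonoidAlgebra.single 1 (mkG ε (fE i))

/-- `f_i` in the extended generalized quantum group. -/
def gF (ε : ZMod n → Fin 2) (i : ZMod n) : UGenSig ε :=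
  SkewMonoidAlgebra.single 1 (mkG ε (fF i))

/-- `k_μ` in the extended generalized quantum group. -/
def gK (ε : ZMod n → Fin 2) (μ : Wt n) : UGenSig ε :=
  SkewMonoidAlgebra.single 1 (mkG ε (fK μ))

/-- The elements of the group `Sig n` in the extended generalized quantum group. -/
def gS (ε : ZMod n → Fin 2) : Sig n →* UGenSig ε := SkewMonoidAlgebra.of (UGen ε) (Sig n)

/-! ### The subalgebras -/

/-- The set of generators `E_i, F_i, K_i, K_i⁻¹, K_{±Λ₀}, σ_j`. -/
def genSetS (ε : ZMod n → Fin 2) : Set (USuperSig ε) :=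
  {x | (∃ i, x = sE ε i) ∨ (∃ i, x = sF ε i) ∨ (∃ i, x = sK ε (root i)) ∨
    (∃ i, x = sK ε (-root i)) ∨ x = sK ε (Lam n) ∨ x = sK ε (-Lam n) ∨ ∃ j, x = sS ε (sig j)}

/-- The set of generators `e_i, f_i, k_i, k_i⁻¹, k_{±Λ₀}, σ_j`. -/
def genSetG (ε : ZMod n → Fin 2) : Set (UGenSig ε) :=
  {x | (∃ i, x = gE ε i) ∨ (∃ i, x = gF ε i) ∨ (∃ i, x = gK ε (root i)) ∨
    (∃ i, x = gK ε (-root i)) ∨ x = gK ε (Lam n) ∨ x = gK ε (-Lam n) ∨ ∃ j, x = gS ε (sig j)}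

/-- The subalgebra `𝒳` of the extended quantum affine superalgebra. -/
def subX (ε : ZMod n → Fin 2) : Subalgebra Kq (USuperSig ε) := Algebra.adjoin Kq (genSetS ε)

/-- The subalgebra `𝒴` of the extended generalized quantum group. -/
def subY (ε : ZMod n → Fin 2) : Subalgebra Kq (UGenSig ε) := Algebra.adjoin Kq (genSetG ε)

/-- `E_i` as an element of `𝒳`. -/
def xE (ε : ZMod n → Fin 2) (i : ZMod n) : subX ε :=
  ⟨sE ε i, Algebra.subset_adjoin (Or.inl ⟨i, rfl⟩)⟩

/-- `F_i` as an element of `𝒳`. -/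
def xF (ε : ZMod n → Fin 2) (i : ZMod n) : subX ε :=
  ⟨sF ε i, Algebra.subset_adjoin (Or.inr (Or.inl ⟨i, rfl⟩))⟩

/-- `K_i` as an element of `𝒳`. -/
def xK (ε : ZMod n → Fin 2) (i : ZMod n) : subX ε :=
  ⟨sK ε (root i), Algebra.subset_adjoin (Or.inr (Or.inr (Or.inl ⟨i, rfl⟩)))⟩

/-- `K_{Λ₀}` as an element of `𝒳`. -/
def xLam (ε : ZMod n → Fin 2) : subX ε :=
  ⟨sK ε (Lam n),
    Algebra.subset_adjoin (Or.inr (Or.inr (Or.inr (Or.inr (Or.inl rfl)))))⟩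

/-- `σ_j` as an element of `𝒳`. -/
def xS (ε : ZMod n → Fin 2) (j : ZMod n) : subX ε :=
  ⟨sS ε (sig j),
    Algebra.subset_adjoin (Or.inr (Or.inr (Or.inr (Or.inr (Or.inr (Or.inr ⟨j, rfl⟩))))))⟩

/-! ### The assignment `τ` -/

/-- The representative in `{1, …, n}` of an index modulo `n`. -/
def pos (i : ZMod n) : ℕ := if i = 0 then n else i.val

/-- `σ_{≤ i} = σ_1 σ_2 ⋯ σ_i`, where `i` is read in `{1, …, n}`. -/
def sigLE (i : ZMod n) : Sig n := ∏ a ∈ Finset.Icc 1 (pos i), sig (a : ZMod n)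

/-- `ς_i = σ_i σ_{i+1}`. -/
def vsig (i : ZMod n) : Sig n := sig i * sig (i + 1)

/-- For `i` (read in `{1, …, n}`) in a maximal block of consecutive indices on which `ε` is
constant, the last index before that block, i.e. the largest `a < i` with `ε_a ≠ ε_i`
(only used when `ε_1 = 0` and `ε_i = 1`, so that such an `a ≥ 1` exists). -/
def prevEnd (ε : ZMod n → Fin 2) (i : ZMod n) : ℕ :=
  ((Finset.Icc 1 (pos i)).filter fun a : ℕ => ε (a : ZMod n) ≠ ε i).sup id

/-- The position of `i` in its block, counted from `1`; this is the length of the block when `i`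
is the last index of the block. -/
def blockPos (ε : ZMod n → Fin 2) (i : ZMod n) : ℕ := pos i - prevEnd ε i

/-- `τ(E_i)`. In the case `(ε_i, ε_{i+1}) = (1, 0)` the index `i = 0` is read as `n`. -/
def tauE (ε : ZMod n → Fin 2) (i : ZMod n) : UGenSig ε :=
  if ε i = 0 then
    if ε (i + 1) = 0 then gE ε i
    else gE ε i * gS ε (sigLE i)
  else
    if ε (i + 1) = 1 then gE ε i * gS ε (vsig i ^ blockPos ε i)
    else gE ε i * gS ε (sigLE i * vsig i ^ blockPos ε i)

/-- `τ(F_i)`. -/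
def tauF (ε : ZMod n → Fin 2) (i : ZMod n) : UGenSig ε :=
  if ε i = 0 then
    if ε (i + 1) = 0 then gF ε i
    else gF ε i * gS ε (sigLE i * vsig i)
  else
    if ε (i + 1) = 1 then gF ε i * gS ε (vsig i ^ (blockPos ε i - 1))
    else gF ε i * gS ε (sigLE i * vsig i ^ (blockPos ε i - 1))

/-- `τ(K_i)`. -/
def tauK (ε : ZMod n → Fin 2) (i : ZMod n) : UGenSig ε :=
  if ε i = 0 then
    if ε (i + 1) = 0 then gK ε (root i)
    else gK ε (root i) * gS ε (vsig i)
  else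
    if ε (i + 1) = 1 then -(gK ε (root i) * gS ε (vsig i))
    else (-1) ^ blockPos ε i * (gK ε (root i) * gS ε (vsig i))

/-! ### Comultiplications -/

/-- The product `σ = σ_1 ⋯ σ_n`. -/
def sigAll (n : ℕ) [NeZero n] : Sig n := ∏ j, sig j

/-- `Δ` is the comultiplication of the extended quantum affine superalgebra: the Hopf superalgebra
comultiplication `Δ(E_i) = 1 ⊗ E_i + E_i ⊗ K_i⁻¹`, `Δ(F_i) = F_i ⊗ 1 + K_i ⊗ F_i`, made into an
ordinary one by means of the parity element `σ` (which satisfies `σ E_i = (-1)^{p(i)} E_i σ`). -/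
structure IsComulS (ε : ZMod n → Fin 2)
    (Δ : USuperSig ε →ₐ[Kq] USuperSig ε ⊗[Kq] USuperSig ε) : Prop where
  map_K : ∀ μ, Δ (sK ε μ) = sK ε μ ⊗ₜ sK ε μ
  map_S : ∀ j, Δ (sS ε (sig j)) = sS ε (sig j) ⊗ₜ sS ε (sig j)
  map_E : ∀ i, Δ (sE ε i) =
    sS ε (sigAll n ^ par ε i) ⊗ₜ sE ε i + sE ε i ⊗ₜ sK ε (-root i)
  map_F : ∀ i, Δ (sF ε i) =
    sF ε i ⊗ₜ 1 + (sK ε (root i) * sS ε (sigAll n ^ par ε i)) ⊗ₜ sF ε i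

/-- `Δ` is the comultiplication of the extended generalized quantum group. -/
structure IsComulG (ε : ZMod n → Fin 2)
    (Δ : UGenSig ε →ₐ[Kq] UGenSig ε ⊗[Kq] UGenSig ε) : Prop where
  map_K : ∀ μ, Δ (gK ε μ) = gK ε μ ⊗ₜ gK ε μ
  map_S : ∀ j, Δ (gS ε (sig j)) = gS ε (sig j) ⊗ₜ gS ε (sig j)
  map_E : ∀ i, Δ (gE ε i) = 1 ⊗ₜ gE ε i + gE ε i ⊗ₜ gK ε (-root i)
  map_F : ∀ i, Δ (gF ε i) = gF ε i ⊗ₜ 1 + gK ε (root i) ⊗ₜ gF ε i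

/-- `τ` preserves comultiplication: `(τ ⊗ τ) ∘ Δ = Δ ∘ τ` on `𝒳`. Here `w ∈ 𝒳 ⊗ 𝒳` is the element
whose image under the (injective) map induced by the inclusion is `Δ(x)`. -/
def PreservesComul (ε : ZMod n → Fin 2) (τ : subX ε ≃ₐ[Kq] subY ε)
    (ΔS : USuperSig ε →ₐ[Kq] USuperSig ε ⊗[Kq] USuperSig ε)
    (ΔG : UGenSig ε →ₐ[Kq] UGenSig ε ⊗[Kq] UGenSig ε) : Prop :=
  ∀ (x : subX ε) (w : subX ε ⊗[Kq] subX ε),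
    Algebra.TensorProduct.map (subX ε).val (subX ε).val w = ΔS x →
      Algebra.TensorProduct.map ((subY ε).val.comp τ.toAlgHom) ((subY ε).val.comp τ.toAlgHom) w =
        ΔG (τ x)

end QSuper

end

noncomputable section

set_option linter.unusedSectionVars false

namespace QSuper

variable {n : ℕ} [NeZero n]

/-! The map τ is a twist by signs. Let `S` be a homomorphism from the group of the σ_j to an algebra
whose values commute with the K_μ and act on E_i and F_i by the character χ_i. Replace E_i by E_i
S(w_i), F_i by F_i S(w_i s_i), and K_μ by ±K_μ S(s_μ), where s_i is the value of s at α_i. The core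
statement is `superRep_twist_iff`: the twisted family satisfies the super relations if and only if
the original one satisfies those of the generalized quantum group.

Collecting group elements on the right of a monomial costs only signs, and for i ≠ j the product
χ_j(w_i) χ_i(w_j) decides everything. It has to be (-1)^{p(i)p(j)}, which creates the super signs,
times (-1)^ε at the δ shared by adjacent roots, which exchanges [2] and (-1)^{ε_i}[2]. This is
`chi_twE_mul`. The factor σ_{≤i}^{p(i)} of w_i supplies the first sign, since of two distinct
indices exactly one precedes the other; ε_1 = 0 makes it harmless to cut the cycle between n and 1.
The factor ς_i^{m_i} supplies the second, since consecutive positions in a block of ones have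
opposite parity. The diagonal value χ_i(w_i) accounts for the sign in τ(K_i) (`chi_twE_self`). The
s_i and these signs extend to all weights so as to absorb the ratio of 𝐪(μ, α_i) and q^{(μ|α_i)}
(`exists_weight_twist`).

All signs and group elements involved square to 1, so twisting twice is the identity. The twists
therefore give mutually inverse maps between U[σ] and 𝒰[σ] (`exists_equiv`), which match 𝒳 with 𝒴
(`map_subX`).

For the coproduct of 𝒰[σ], the Serre relations are additive for two families that commute up to
𝐪(α_i, α_j) (`GenSerre.add`); those of U[σ] follow by twisting inside the tensor square. Finally,
some K_i is sent to -u with u group-like and invertible. Then (-u) ⊗ (-u) = u ⊗ u, whereas Δ(-u) =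
-(u ⊗ u), so τ does not respect Δ. -/

theorem eq_zero_or_one (a : Fin 2) : a = 0 ∨ a = 1 := by
  fin_cases a <;> simp

/-! ### Nonvanishing in the ground field and small residues modulo n -/

theorem q_ne_zero : q ≠ 0 := RatFunc.X_ne_zero

theorem qi_ne_zero (ε : ZMod n → Fin 2) (i : ZMod n) : qi ε i ≠ 0 := by
  unfold qi; split_ifs <;> simp [q_ne_zero]

theorem q_ne_one : q ≠ 1 := by
  intro h
  have := congrArg (RatFunc.eval (RingHom.id ℚ) 0) h
  simp [q] at this

theorem q_ne_neg_one : q ≠ -1 := by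
  intro h
  have h2 : q + 1 = 0 := by rw [h]; ring
  have := congrArg (RatFunc.eval (RingHom.id ℚ) 0) h2
  rw [RatFunc.eval_add] at this <;> simp [q] at this ⊢

theorem q_sub_inv_ne_zero : q - q⁻¹ ≠ 0 := by
  intro h
  have h0 := q_ne_zero
  have : (q - 1) * (q + 1) = 0 := by field_simp at h; linear_combination h
  rcases mul_eq_zero.1 this with h | h
  · exact q_ne_one (sub_eq_zero.1 h)
  · exact q_ne_neg_one (eq_neg_of_add_eq_zero_left h)

theorem two_eq : two = q + q⁻¹ := by
  rw [two, div_eq_iff q_sub_inv_ne_zero]; ring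

/-- Since q_i is q or -q⁻¹, the signed quantum integer has the form v + v⁻¹ with v = q_i. This lets
the additivity of the Serre relations be checked for both parities at once. -/
theorem two_qi (ε : ZMod n → Fin 2) (i : ZMod n) :
    (-1) ^ (ε i : ℕ) * two = qi ε i + (qi ε i)⁻¹ := by
  rw [two_eq, qi]
  rcases eq_zero_or_one (ε i) with h | h <;> simp [h]

theorem self_ne_succ (hn : 4 ≤ n) (i : ZMod n) : i ≠ i + 1 := by
  intro h
  have h1 : ((1 : ℕ) : ZMod n) = 0 := by
    push_cast; exact (left_eq_add.1 h)
  rw [ZMod.natCast_eq_zero_iff] at h1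
  exact absurd (Nat.le_of_dvd one_pos h1) (by omega)

theorem two_ne_zero' (hn : 4 ≤ n) : (2 : ZMod n) ≠ 0 := by
  intro h
  have h1 : ((2 : ℕ) : ZMod n) = 0 := by exact_mod_cast h
  rw [ZMod.natCast_eq_zero_iff] at h1
  exact absurd (Nat.le_of_dvd two_pos h1) (by omega)

/-- Ensures that the outer indices i - 1 and i + 1 of a quartic relation are not adjacent; here n =
3 is excluded. -/
theorem three_ne_zero' (hn : 4 ≤ n) : (3 : ZMod n) ≠ 0 := by
  intro h
  have h1 : ((3 : ℕ) : ZMod n) = 0 := by exact_mod_cast h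
  rw [ZMod.natCast_eq_zero_iff] at h1
  exact absurd (Nat.le_of_dvd three_pos h1) (by omega)

theorem one_ne_zero' (hn : 4 ≤ n) : (1 : ZMod n) ≠ 0 := by
  simpa using (self_ne_succ hn (0 : ZMod n)).symm

/-! ### The two forms and the characters χ_i on simple roots -/

theorem form_root (ε : ZMod n → Fin 2) (μ : Wt n) (i : ZMod n) :
    form ε μ (root i) = (-1) ^ (ε i : ℕ) * μ.1 i - (-1) ^ (ε (i + 1) : ℕ) * μ.1 (i + 1)
      + (if i = 0 then μ.2.2 else 0) := by
  simp only [form, root, Pi.sub_apply, mul_sub, Finset.sum_sub_distrib]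
  simp [Pi.single_apply]

theorem form_comm (ε : ZMod n → Fin 2) (μ ν : Wt n) : form ε μ ν = form ε ν μ := by
  simp only [form]
  congr 1
  · exact Finset.sum_congr rfl fun j _ => by ring
  · ring

theorem form_neg (ε : ZMod n → Fin 2) (μ ν : Wt n) : form ε (-μ) ν = -form ε μ ν := by
  simp only [form, Prod.fst_neg, Prod.snd_neg, Pi.neg_apply, neg_mul, mul_neg,
    Finset.sum_neg_distrib]
  ring

theorem bq_comm (ε : ZMod n → Fin 2) (μ ν : Wt n) : bq ε μ ν = bq ε ν μ := by
  simp only [bq]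
  congr 1
  · exact Finset.prod_congr rfl fun j _ => by rw [mul_comm]
  · congr 1; ring

theorem bq_ne_zero (ε : ZMod n → Fin 2) (μ ν : Wt n) : bq ε μ ν ≠ 0 :=
  mul_ne_zero (Finset.prod_ne_zero_iff.2 fun j _ => zpow_ne_zero _ (qi_ne_zero ε j))
    (zpow_ne_zero _ q_ne_zero)

theorem bq_neg (ε : ZMod n → Fin 2) (μ ν : Wt n) : bq ε (-μ) ν = (bq ε μ ν)⁻¹ := by
  simp only [bq, Prod.fst_neg, Prod.snd_neg, Pi.neg_apply, neg_mul, mul_inv, zpow_neg,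
    Finset.prod_inv_distrib, ← neg_add]

theorem bq_root (ε : ZMod n → Fin 2) (μ : Wt n) (i : ZMod n) :
    bq ε μ (root i) = qi ε i ^ μ.1 i * (qi ε (i + 1) ^ μ.1 (i + 1))⁻¹
      * q ^ (if i = 0 then μ.2.2 else 0) := by
  have h : ∀ j, qi ε j ^ (μ.1 j * ((Pi.single i 1 : ZMod n → ℤ) j
      - (Pi.single (i + 1) 1 : ZMod n → ℤ) j))
      = (if j = i then qi ε j ^ μ.1 j else 1) * (if j = i + 1 then (qi ε j ^ μ.1 j)⁻¹ else 1) := by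
    intro j
    rw [mul_sub, zpow_sub₀ (qi_ne_zero ε j)]
    simp only [Pi.single_apply]
    split_ifs <;> simp [div_eq_mul_inv]
  simp only [bq, root, Pi.sub_apply, h, Finset.prod_mul_distrib]
  simp

/-- The pairing (δ_j | α_i) is ±1 at j = i and j = i + 1 and vanishes elsewhere; on elements of
order two the sign of the exponent is irrelevant. -/
theorem chi_apply (hn : 4 ≤ n) (ε : ZMod n → Fin 2) (i : ZMod n) (g : Sig n) :
    chi ε i g = g i ^ (ε i : ℕ) * g (i + 1) ^ (ε (i + 1) : ℕ) := by
  change ∏ j, g j ^ ((ε j : ℕ) * form ε (del j) (root i)) = _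
  have h : ∀ j, g j ^ ((ε j : ℕ) * form ε (del j) (root i))
      = (if j = i then g j ^ (ε j : ℕ) else 1) * (if j = i + 1 then g j ^ (ε j : ℕ) else 1) := by
    intro j
    have h1 := self_ne_succ hn i
    rw [form_root]
    simp only [del, Pi.single_apply]
    rcases Int.units_eq_one_or (g j) with hg | hg <;>
    rcases eq_zero_or_one (ε i) with ha | ha <;>
    rcases eq_zero_or_one (ε (i + 1)) with hb | hb <;>
    by_cases hj : j = i <;> by_cases hj' : j = i + 1 <;>
    simp_all [eq_comm]
  simp only [h, Finset.prod_mul_distrib]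
  simp

theorem chik_eq (hn : 4 ≤ n) (ε : ZMod n → Fin 2) (g : Sig n) (i : ZMod n) :
    chik ε g i = ((g i : ℤ) : Kq) ^ (ε i : ℕ) * ((g (i + 1) : ℤ) : Kq) ^ (ε (i + 1) : ℕ) := by
  simp [chik, chi_apply hn]

/-! ### Positions and the signs of the twisting group elements -/

theorem pos_le (i : ZMod n) : pos i ≤ n := by
  unfold pos; split_ifs
  · exact le_rfl
  · exact (ZMod.val_lt i).le

theorem one_le_pos (i : ZMod n) : 1 ≤ pos i := by
  unfold pos; split_ifs with h
  · exact NeZero.one_le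
  · exact Nat.one_le_iff_ne_zero.2 fun h0 => h ((ZMod.val_eq_zero i).1 h0)

@[simp] theorem natCast_pos (i : ZMod n) : ((pos i : ℕ) : ZMod n) = i := by
  unfold pos; split_ifs with h
  · simp [h]
  · simp

theorem pos_inj {i j : ZMod n} : pos i = pos j ↔ i = j :=
  ⟨fun h => by rw [← natCast_pos i, h, natCast_pos], fun h => h ▸ rfl⟩

theorem pos_natCast {a : ℕ} (h1 : 1 ≤ a) (h2 : a ≤ n) : pos (a : ZMod n) = a := by
  unfold pos
  rcases h2.eq_or_lt with rfl | h2
  · simp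
  · rw [if_neg, ZMod.val_natCast_of_lt h2]
    rw [ZMod.natCast_eq_zero_iff]
    exact fun h => absurd (Nat.le_of_dvd h1 h) (by omega)

theorem pos_zero : pos (0 : ZMod n) = n := if_pos rfl

theorem pos_succ {i : ZMod n} (hi : i ≠ 0) : pos (i + 1) = pos i + 1 := by
  have h : pos i < n := lt_of_le_of_ne (pos_le i) fun h => hi (pos_inj.1 (h.trans pos_zero.symm))
  have := pos_natCast (n := n) (a := pos i + 1) (by omega) (by omega)
  simpa using this

theorem sigLE_apply (i j : ZMod n) : sigLE i j = if pos j ≤ pos i then -1 else 1 := by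
  rw [sigLE, Finset.prod_apply]
  have h : ∀ a ∈ Finset.Icc 1 (pos i), sig (a : ZMod n) j = if a = pos j then -1 else 1 := by
    intro a ha
    rw [Finset.mem_Icc] at ha
    rw [sig, Pi.mulSingle_apply]
    congr 1
    rw [eq_iff_iff]
    constructor
    · rintro rfl; exact (pos_natCast ha.1 (ha.2.trans (pos_le i))).symm
    · rintro rfl; simp
  rw [Finset.prod_congr rfl h, Finset.prod_ite_eq']
  simp [one_le_pos]

/-- As a function, σ_{≤i} is -1 exactly at the positions up to i. For j before i both δ_j and
δ_{j+1} are covered, for j = i only δ_i, for j after i neither. The exception would be j = n, where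
δ_{j+1} = δ_1 is always covered, but ε_1 = 0 removes its contribution. -/
theorem chi_sigLE (hn : 4 ≤ n) {ε : ZMod n → Fin 2} (hε : ε 1 = 0) (i j : ZMod n) :
    chi ε j (sigLE i) = if j = i then (-1) ^ (ε i : ℕ) else
      if pos j < pos i then (-1) ^ par ε j else 1 := by
  rw [chi_apply hn, sigLE_apply, sigLE_apply, par, pow_add]
  by_cases hj : j = 0
  · subst hj
    have := pos_le i
    simp only [pos_zero, zero_add, hε]
    by_cases hi : i = 0
    · simp [hi, pos_zero]
    · have : ¬ n ≤ pos i := fun h => hi (pos_inj.1 ((le_antisymm (pos_le i) h).trans pos_zero.symm))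
      simp [this, Ne.symm hi, show ¬ n < pos i by omega]
  · rw [pos_succ hj]
    by_cases hi : j = i
    · simp [hi]
    · have := (pos_inj (i := j) (j := i)).not.2 hi
      by_cases h : pos j < pos i
      · simp [hi, h, h.le, Nat.succ_le_of_lt h]
      · simp [hi, h, show ¬ pos j ≤ pos i by omega]

theorem chi_vsig_self (hn : 4 ≤ n) (ε : ZMod n → Fin 2) (i : ZMod n) :
    chi ε i (vsig i) = (-1) ^ par ε i := by
  rw [chi_apply hn, par, pow_add]
  simp [vsig, sig, self_ne_succ hn i]

theorem chi_vsig (hn : 4 ≤ n) (ε : ZMod n → Fin 2) {i j : ZMod n} (hij : i ≠ j) :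
    chi ε j (vsig i) = (if j = i + 1 then (-1) ^ (ε j : ℕ) else 1) *
      (if i = j + 1 then (-1) ^ (ε i : ℕ) else 1) := by
  rw [chi_apply hn]
  have h1 : i = j + 1 ↔ j + 1 = i := eq_comm
  simp only [vsig, sig, Pi.mul_apply, Pi.mulSingle_apply, h1, hij.symm, add_left_inj, if_false,
    one_mul, mul_one]
  by_cases h : j + 1 = i
  · subst h; split_ifs <;> simp
  · split_ifs <;> simp

/-- The index itself fails the filter, and an empty filter has supremum 0, still below every
position. -/
theorem prevEnd_lt (ε : ZMod n → Fin 2) (i : ZMod n) : prevEnd ε i < pos i := by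
  rw [prevEnd, Finset.sup_lt_iff (by exact one_le_pos i)]
  intro a ha
  rw [Finset.mem_filter, Finset.mem_Icc] at ha
  refine lt_of_le_of_ne ha.1.2 fun h => ha.2 ?_
  rw [show a = pos i from h, natCast_pos]

theorem one_le_blockPos (ε : ZMod n → Fin 2) (i : ZMod n) : 1 ≤ blockPos ε i :=
  Nat.sub_pos_of_lt (prevEnd_lt ε i)

theorem blockPos_succ_of_eq {ε : ZMod n → Fin 2} {i : ZMod n} (hi : i ≠ 0)
    (h : ε i = ε (i + 1)) : blockPos ε (i + 1) = blockPos ε i + 1 := by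
  have h1 : prevEnd ε (i + 1) = prevEnd ε i := by
    -- The interval grows by the position of i + 1 only, which the filter rejects.
    rw [prevEnd, prevEnd, pos_succ hi, ← Finset.insert_Icc_right_eq_Icc_add_one (by omega),
      Finset.filter_insert]
    simp [h]
  have := prevEnd_lt ε i
  rw [blockPos, blockPos, h1, pos_succ hi]
  omega

theorem blockPos_succ_of_ne {ε : ZMod n → Fin 2} {i : ZMod n} (hi : i ≠ 0)
    (h : ε i ≠ ε (i + 1)) : blockPos ε (i + 1) = 1 := by
  have h1 : pos i ≤ prevEnd ε (i + 1) := by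
    apply Finset.le_sup (f := id)
    change pos i ∈ _
    rw [Finset.mem_filter, Finset.mem_Icc, pos_succ hi, natCast_pos]
    exact ⟨⟨one_le_pos i, by omega⟩, h⟩
  have := prevEnd_lt ε (i + 1)
  rw [pos_succ hi] at this
  rw [blockPos, pos_succ hi]
  omega

/-! ### The twisting elements attached to simple roots and their signs -/

theorem Sig.mul_self (g : Sig n) : g * g = 1 := by
  funext j; exact Int.units_mul_self (g j)

/-- The group element `g` with `τ(E_i) = e_i g`. -/
def twE (ε : ZMod n → Fin 2) (i : ZMod n) : Sig n :=
  sigLE i ^ par ε i * vsig i ^ ((ε i : ℕ) * blockPos ε i)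

/-- The group element `s` with `τ(K_i) = ± k_i s`. -/
def twK (ε : ZMod n → Fin 2) (i : ZMod n) : Sig n :=
  if ε i = 0 ∧ ε (i + 1) = 0 then 1 else vsig i

/-- The group element `h` with `τ(F_i) = f_i h`. -/
def twF (ε : ZMod n → Fin 2) (i : ZMod n) : Sig n := twE ε i * twK ε i

/-- The sign in `τ(K_i)`. -/
def twC (ε : ZMod n → Fin 2) (i : ZMod n) : ℤˣ :=
  if ε i = 0 then 1 else if ε (i + 1) = 1 then -1 else (-1) ^ blockPos ε i

/-- The exponent p(i) of σ_{≤i} matters only modulo 2, so a single formula covers the four cases. -/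
theorem tauE_eq (ε : ZMod n → Fin 2) (i : ZMod n) : tauE ε i = gE ε i * gS ε (twE ε i) := by
  rcases eq_zero_or_one (ε i) with h | h <;> rcases eq_zero_or_one (ε (i + 1)) with h' | h' <;>
    simp [tauE, twE, par, h, h', pow_two, Sig.mul_self]

theorem tauF_eq (ε : ZMod n → Fin 2) (i : ZMod n) : tauF ε i = gF ε i * gS ε (twF ε i) := by
  -- Because m_i ≥ 1, the truncated difference m_i - 1 is a true one, and multiplying by the
  -- involution ς_i has the same effect as lowering the exponent by one.
  obtain ⟨m, hm⟩ := Nat.exists_eq_add_of_le' (one_le_blockPos ε i)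
  have hv (m : ℕ) : vsig i ^ (m + 1) * vsig i = vsig i ^ m := by
    rw [pow_succ, mul_assoc, Sig.mul_self, mul_one]
  rcases eq_zero_or_one (ε i) with h | h <;> rcases eq_zero_or_one (ε (i + 1)) with h' | h' <;>
    simp [tauF, twE, twF, twK, par, h, h', pow_two, Sig.mul_self, hm, hv, mul_assoc, -map_mul]

theorem tauK_eq (ε : ZMod n → Fin 2) (i : ZMod n) :
    tauK ε i = ((twC ε i : ℤ) : Kq) • (gK ε (root i) * gS ε (twK ε i)) := by
  rcases eq_zero_or_one (ε i) with h | h <;> rcases eq_zero_or_one (ε (i + 1)) with h' | h' <;>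
    simp [tauK, twC, twK, h, h', Algebra.smul_def, -SkewMonoidAlgebra.coe_algebraMap]

theorem chi_twK_self (hn : 4 ≤ n) (ε : ZMod n → Fin 2) (i : ZMod n) :
    chi ε i (twK ε i) = (-1) ^ par ε i := by
  rw [twK]; split_ifs with h
  · simp [par, h.1, h.2]
  · exact chi_vsig_self hn ε i

theorem chi_twK (hn : 4 ≤ n) (ε : ZMod n → Fin 2) {i j : ZMod n} (hij : i ≠ j) :
    chi ε j (twK ε i) = (if j = i + 1 then (-1) ^ (ε j : ℕ) else 1) *
      (if i = j + 1 then (-1) ^ (ε i : ℕ) else 1) := by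
  rw [twK]
  by_cases h : ε i = 0 ∧ ε (i + 1) = 0
  · rw [if_pos h, map_one, h.1]
    by_cases h1 : j = i + 1
    · rw [h1, h.2]; simp
    · simp [h1]
  · rw [if_neg h, chi_vsig hn ε hij]

/-- The value of `χ_j` on `ς_i`, which is symmetric in `i ≠ j`. -/
def adjSign (ε : ZMod n → Fin 2) (i j : ZMod n) : ℤˣ :=
  (if j = i + 1 then (-1) ^ (ε j : ℕ) else 1) * (if i = j + 1 then (-1) ^ (ε i : ℕ) else 1)

theorem adjSign_comm (ε : ZMod n → Fin 2) (i j : ZMod n) : adjSign ε i j = adjSign ε j i :=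
  mul_comm _ _

/-- If ε_{i+1} = 1, the exponent is odd: either i + 1 opens a block and has position 1, or i and i +
1 lie in one block at consecutive positions. The wrap-around i = n does not occur, as ε_1 = 0. -/
theorem adjSign_pow {ε : ZMod n → Fin 2} (hε : ε 1 = 0) (i : ZMod n) :
    ((-1 : ℤˣ) ^ (ε (i + 1) : ℕ)) ^
      ((ε i : ℕ) * blockPos ε i + (ε (i + 1) : ℕ) * blockPos ε (i + 1)) =
      (-1) ^ (ε (i + 1) : ℕ) := by
  rcases eq_zero_or_one (ε (i + 1)) with h' | h'
  · simp [h']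
  have hi : i ≠ 0 := by rintro rfl; simp [hε] at h'
  rcases eq_zero_or_one (ε i) with h | h
  · rw [blockPos_succ_of_ne hi (by simp [h, h'])]; simp [h, h']
  · rw [blockPos_succ_of_eq hi (by simp [h, h'])]; simp [h, h', pow_add, ← mul_pow]

/-- The exchange sign of two distinct generators. The σ_{≤} parts give the super sign, because
exactly one of the two characters sees the full step; the ς parts give the adjacency sign by
`adjSign_pow`. -/
theorem chi_twE_mul (hn : 4 ≤ n) {ε : ZMod n → Fin 2} (hε : ε 1 = 0) {i j : ZMod n}
    (hij : i ≠ j) :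
    chi ε j (twE ε i) * chi ε i (twE ε j) = (-1) ^ (par ε i * par ε j) * adjSign ε i j := by
  have h1 : chi ε j (sigLE i) ^ par ε i * chi ε i (sigLE j) ^ par ε j =
      (-1) ^ (par ε i * par ε j) := by
    rw [chi_sigLE hn hε, chi_sigLE hn hε, if_neg hij, if_neg hij.symm]
    rcases lt_or_gt_of_ne (pos_inj.not.2 hij) with h | h
    · rw [if_neg h.not_gt, if_pos h, one_pow, one_mul, pow_mul]
    · rw [if_neg h.not_gt, if_pos h, one_pow, mul_one, mul_comm (par ε i), pow_mul]
  have h2 : chi ε j (vsig i) ^ ((ε i : ℕ) * blockPos ε i) *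
      chi ε i (vsig j) ^ ((ε j : ℕ) * blockPos ε j) = adjSign ε i j := by
    rw [chi_vsig hn ε hij, chi_vsig hn ε hij.symm]
    change adjSign ε i j ^ _ * adjSign ε j i ^ _ = _
    rw [adjSign_comm ε j i, ← pow_add]
    -- Two indices cannot be successors of one another, so at most one factor of `adjSign` is
    -- nontrivial.
    have hne : ∀ k : ZMod n, k ≠ k + 1 + 1 := fun k h => two_ne_zero' hn (by linear_combination -h)
    rw [adjSign]
    by_cases hj : j = i + 1
    · subst hj
      simp only [if_true, hne, if_false, mul_one, adjSign_pow hε]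
    · by_cases hi : i = j + 1
      · subst hi
        simp only [if_true, hne, if_false, one_mul, add_comm (_ * blockPos ε (j + 1)),
          adjSign_pow hε]
      · simp [hi, hj]
  rw [← h1, ← h2, twE, twE]
  simp only [map_mul, map_pow]
  exact mul_mul_mul_comm _ _ _ _

/-- This identity dictates the sign in τ(K_i): it makes the commutator of the twisted E_i and F_i
come out with the coefficient (-1)^{ε_i}/(q - q⁻¹) of the super relation. -/
theorem chi_twE_self (hn : 4 ≤ n) {ε : ZMod n → Fin 2} (hε : ε 1 = 0) (i : ZMod n) :
    chi ε i (twE ε i) = (-1) ^ (ε i : ℕ) * twC ε i := by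
  simp only [twE, map_mul, map_pow, chi_sigLE hn hε, chi_vsig_self hn, if_true, twC]
  rcases eq_zero_or_one (ε i) with h | h <;> rcases eq_zero_or_one (ε (i + 1)) with h' | h' <;>
    simp [par, h, h']

/-! ### Extending assignments on simple roots to the weight lattice -/

/-- The values on the α_i may be prescribed freely. Those with i ≠ 0 determine the images of the δ_j
recursively, starting from 1 at δ_1; α_0 is the only root involving δ, whose image absorbs what is
left after going round the cycle. -/
theorem exists_hom_root {G : Type*} [CommGroup G] (z : ZMod n → G) :
    ∃ φ : Wt n → G, φ 0 = 1 ∧ (∀ μ ν, φ (μ + ν) = φ μ * φ ν) ∧ (∀ i, φ (root i) = z i) ∧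
      φ (Lam n) = 1 := by
  let w : ZMod n → G := fun j => ∏ a ∈ Finset.range (pos j - 1), (z ((a + 1 : ℕ) : ZMod n))⁻¹
  have hw : ∀ j, j ≠ 0 → w (j + 1) = w j * (z j)⁻¹ := by
    intro j hj
    obtain ⟨m, hm⟩ := Nat.exists_eq_add_of_le' (one_le_pos j)
    have hz : ((m + 1 : ℕ) : ZMod n) = j := by rw [← hm, natCast_pos]
    simp only [w, pos_succ hj, hm, Nat.add_sub_cancel, Finset.prod_range_succ, hz]
  refine ⟨fun μ => (∏ j, w j ^ μ.1 j) * (z 0 * w 1 * (w 0)⁻¹) ^ μ.2.1, by simp, ?_, ?_, by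
    simp [Lam]⟩
  · intro μ ν
    simp only [Prod.fst_add, Prod.snd_add, Pi.add_apply, zpow_add, Finset.prod_mul_distrib]
    exact mul_mul_mul_comm _ _ _ _
  · intro i
    have h1 : ∏ j, w j ^ (root i).1 j = w i * (w (i + 1))⁻¹ := by
      simp only [root, Pi.sub_apply, zpow_sub, Finset.prod_mul_distrib, Pi.single_apply]
      simp [apply_ite]
    change (∏ j, w j ^ (root i).1 j) * _ = _
    rw [h1]
    by_cases hi : i = 0
    · subst hi
      simp only [root, if_true, zpow_one, zero_add]
      rw [mul_comm]
      group
    · simp [root, hi, hw i hi]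

/-- Group elements and signs attached to weights, which extend those attached to simple roots and
relate the forms `(- | -)` and `𝐪`. -/
structure IsWeightTwist (ε : ZMod n → Fin 2) (s : Wt n → Sig n) (c : Wt n → ℤˣ) : Prop where
  s_zero : s 0 = 1
  c_zero : c 0 = 1
  s_add : ∀ μ ν, s (μ + ν) = s μ * s ν
  c_add : ∀ μ ν, c (μ + ν) = c μ * c ν
  s_root : ∀ i, s (root i) = twK ε i
  c_root : ∀ i, c (root i) = twC ε i
  s_Lam : s (Lam n) = 1
  c_Lam : c (Lam n) = 1
  bq_eq : ∀ μ i, bq ε μ (root i) = q ^ form ε μ (root i) * chik ε (s μ) i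

/-- The natural candidate is d(μ)_j = (-1)^{ε_j μ_j}, the sign of q_j^{μ_j}. On α_i it may differ
from the prescribed `twK ε i`, but only by an element on which every χ_k is trivial. A homomorphism
into the common kernel corrects this without disturbing the relation to 𝐪. -/
theorem exists_weight_twist (hn : 4 ≤ n) (ε : ZMod n → Fin 2) :
    ∃ (s : Wt n → Sig n) (c : Wt n → ℤˣ), IsWeightTwist ε s c := by
  obtain ⟨c, c0, cadd, croot, clam⟩ := exists_hom_root (twC ε)
  -- The common kernel of all χ_i, containing every σ_b with ε_b = 0.
  let N : Subgroup (Sig n) := ⨅ i, (chi ε i).ker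
  have hN : ∀ g, g ∈ N ↔ ∀ i, chi ε i g = 1 := by
    intro g; simp [N, Subgroup.mem_iInf, MonoidHom.mem_ker]
  have hσ : ∀ b, ε b = 0 → sig b ∈ N := by
    intro b hb
    rw [hN]; intro i; rw [chi_sig, hb]; simp
  let d : Wt n → Sig n := fun μ j => (-1) ^ ((ε j : ℕ) * μ.1 j)
  have dadd : ∀ μ ν, d (μ + ν) = d μ * d ν := by
    intro μ ν; funext j; simp [d, mul_add, zpow_add]
  have hz : ∀ i, twK ε i * d (root i) ∈ N := by
    intro i
    have hd : d (root i) = sig i ^ (ε i : ℕ) * sig (i + 1) ^ (ε (i + 1) : ℕ) := by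
      funext j
      simp only [d, root, sig, Pi.sub_apply, Pi.mul_apply, Pi.pow_apply, Pi.single_apply,
        Pi.mulSingle_apply]
      have h1 := self_ne_succ hn i
      by_cases hj : j = i
      · subst hj; simp [h1]
      · by_cases hj' : j = i + 1
        · subst hj'; simp [hj]
        · simp [hj, hj']
    rw [hd, twK, vsig]
    -- The discrepancy is trivial when ε_i = ε_{i+1}; otherwise it is the σ_b of the endpoint with
    -- ε_b = 0.
    rcases eq_zero_or_one (ε i) with h | h <;> rcases eq_zero_or_one (ε (i + 1)) with h' | h'
    · simp [h, h', N.one_mem]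
    · have : sig i * sig (i + 1) * sig (i + 1) = sig i := by
        rw [mul_assoc, Sig.mul_self, mul_one]
      simpa [h, h', this] using hσ i h
    · have : sig i * sig (i + 1) * sig i = sig (i + 1) := by
        rw [mul_right_comm, Sig.mul_self, one_mul]
      simpa [h, h', this] using hσ _ h'
    · have : sig i * sig (i + 1) * (sig i * sig (i + 1)) = 1 := Sig.mul_self _
      simp [h, h', this, N.one_mem]
  obtain ⟨r, r0, radd, rroot, rlam⟩ := exists_hom_root (G := N) fun i => ⟨_, hz i⟩
  refine ⟨fun μ => d μ * r μ, c, ?_, c0, ?_, cadd, ?_, croot, ?_, clam, ?_⟩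
  · funext j; simp [d, r0]
  · intro μ ν
    simp only [dadd, radd, Subgroup.coe_mul]
    exact mul_mul_mul_comm _ _ _ _
  · intro i
    simp only [rroot]
    rw [mul_left_comm, Sig.mul_self, mul_one]
  · funext j; simp only [rlam]; simp [d, Lam]
  · intro μ i
    have h1 : chik ε (d μ * r μ) i = chik ε (d μ) i := by
      rw [chik_mul, show chik ε (r μ : Sig n) i = 1 by simp [chik, (hN _).1 (r μ).2 i], mul_one]
    rw [h1, chik_eq hn, bq_root, form_root, zpow_add₀ q_ne_zero, zpow_sub₀ q_ne_zero]
    -- For ε_j = 1, (-q⁻¹)^m splits as q^{-m} times (-1)^m, and (-1)^m is the j-th entry of d(μ).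
    have h2 : ∀ j, qi ε j ^ μ.1 j =
        q ^ ((-1) ^ (ε j : ℕ) * μ.1 j) * (((d μ j : ℤˣ) : ℤ) : Kq) ^ (ε j : ℕ) := by
      intro j
      rcases eq_zero_or_one (ε j) with h | h
      · simp [qi, h]
      · rw [qi, h]
        simp only [d, h]
        rw [if_neg (by decide), neg_eq_neg_one_mul, mul_zpow, inv_zpow']
        rcases Int.even_or_odd (μ.1 j) with he | ho
        · simp [he.neg_one_zpow]
        · simp [ho.neg_one_zpow]
    have h3 : ((((d μ (i + 1) : ℤˣ) : ℤ) : Kq) ^ (ε (i + 1) : ℕ))⁻¹ =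
        (((d μ (i + 1) : ℤˣ) : ℤ) : Kq) ^ (ε (i + 1) : ℕ) := by
      rcases Int.units_eq_one_or (d μ (i + 1)) with h | h <;> simp [h, ← inv_pow, inv_neg]
    rw [h2, h2, mul_inv, h3]
    ring

/-! ### Representations of the two presentations -/

section Rep

variable {B : Type*} [Ring B] [Algebra Kq B]

/-- The relations of the generalized quantum group that involve only the `e_i`. -/
structure GenSerre (ε : ZMod n → Fin 2) (X : ZMod n → B) : Prop where
  sq : ∀ i, IsOdd ε i → X i ^ 2 = 0
  comm : ∀ i j, i - j ≠ 1 → i - j ≠ -1 → qbr 1 (X i) (X j) = 0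
  cubic : ∀ i j, IsEven ε i → (i - j = 1 ∨ i - j = -1) →
    QSuper.cubic ((-1) ^ (ε i : ℕ) * two) (X i) (X j) = 0
  quartic : ∀ i, IsOdd ε i →
    QSuper.quartic ((-1) ^ (ε i : ℕ) * two) (X (i - 1)) (X i) (X (i + 1)) = 0

/-- The relations of the quantum affine superalgebra that involve only the `E_i`. -/
structure SuperSerre (ε : ZMod n → Fin 2) (X : ZMod n → B) : Prop where
  sq : ∀ i, IsOdd ε i → X i ^ 2 = 0
  comm : ∀ i j, i - j ≠ 1 → i - j ≠ -1 → qbr ((-1) ^ (par ε i * par ε j)) (X i) (X j) = 0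
  cubic : ∀ i j, IsEven ε i → (i - j = 1 ∨ i - j = -1) → QSuper.cubic two (X i) (X j) = 0
  quartic : ∀ i, IsOdd ε i → superSerre ε i (X (i - 1)) (X i) (X (i + 1)) = 0

/-- A homomorphism from the weight lattice to the multiplicative monoid of an algebra. -/
structure WeightHom (K : Wt n → B) : Prop where
  zero : K 0 = 1
  add : ∀ μ ν, K (μ + ν) = K μ * K ν

/-- Elements satisfying the relations of the generalized quantum group. -/
structure GenRep (ε : ZMod n → Fin 2) (K : Wt n → B) (E F : ZMod n → B) : Prop where
  weight : WeightHom K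
  K_E : ∀ μ i, K μ * E i = bq ε μ (root i) • (E i * K μ)
  K_F : ∀ μ i, K μ * F i = (bq ε μ (root i))⁻¹ • (F i * K μ)
  E_F : ∀ i j, E i * F j - F j * E i =
    if i = j then (1 / (q - q⁻¹)) • (K (root i) - K (-root i)) else 0
  serreE : GenSerre ε E
  serreF : GenSerre ε F

/-- Elements satisfying the relations of the quantum affine superalgebra. -/
structure SuperRep (ε : ZMod n → Fin 2) (K : Wt n → B) (E F : ZMod n → B) : Prop where
  weight : WeightHom K
  K_E : ∀ μ i, K μ * E i = q ^ form ε μ (root i) • (E i * K μ)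
  K_F : ∀ μ i, K μ * F i = q ^ (-form ε μ (root i)) • (F i * K μ)
  E_F : ∀ i j, E i * F j - (-1 : Kq) ^ (par ε i * par ε j) • (F j * E i) =
    if i = j then ((-1) ^ (ε i : ℕ) / (q - q⁻¹)) • (K (root i) - K (-root i)) else 0
  serreE : SuperSerre ε E
  serreF : SuperSerre ε F

theorem WeightHom.mul_neg {K : Wt n → B} (h : WeightHom K) (μ : Wt n) : K μ * K (-μ) = 1 := by
  rw [← h.add, add_neg_cancel, h.zero]

theorem WeightHom.neg_mul {K : Wt n → B} (h : WeightHom K) (μ : Wt n) : K (-μ) * K μ = 1 := by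
  rw [← h.add, neg_add_cancel, h.zero]

theorem WeightHom.comm {K : Wt n → B} (h : WeightHom K) (μ ν : Wt n) :
    K μ * K ν = K ν * K μ := by
  rw [← h.add, add_comm, h.add]

/-- Passes from the conjugation form of the presentations to commutation rules, which behave better
under twisting and in tensor products. -/
theorem WeightHom.conj_iff {K : Wt n → B} (h : WeightHom K) (μ : Wt n) (x : B) (c : Kq) :
    K μ * x * K (-μ) = c • x ↔ K μ * x = c • (x * K μ) := by
  constructor
  · intro hx
    rw [← smul_mul_assoc, ← hx, mul_assoc, h.neg_mul, mul_one]
  · intro hx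
    rw [hx, smul_mul_assoc, mul_assoc, h.mul_neg, mul_one]

/-- The images of the generators of the free algebra. -/
def genMap (K : Wt n → B) (E F : ZMod n → B) : Gen n → B
  | Gen.K μ => K μ
  | Gen.E i => E i
  | Gen.F i => F i

/-- The homomorphism from the free algebra with given images of the generators. -/
def evalFr (K : Wt n → B) (E F : ZMod n → B) : Fr n →ₐ[Kq] B := FreeAlgebra.lift Kq (genMap K E F)

@[simp] theorem evalFr_K (K : Wt n → B) (E F : ZMod n → B) (μ : Wt n) :
    evalFr K E F (fK μ) = K μ := by
  simp only [evalFr, fK, FreeAlgebra.lift_ι_apply, genMap]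

@[simp] theorem evalFr_E (K : Wt n → B) (E F : ZMod n → B) (i : ZMod n) :
    evalFr K E F (fE i) = E i := by
  simp only [evalFr, fE, FreeAlgebra.lift_ι_apply, genMap]

@[simp] theorem evalFr_F (K : Wt n → B) (E F : ZMod n → B) (i : ZMod n) :
    evalFr K E F (fF i) = F i := by
  simp only [evalFr, fF, FreeAlgebra.lift_ι_apply, genMap]

theorem GenRep.eval_eq {ε : ZMod n → Fin 2} {K : Wt n → B} {E F : ZMod n → B}
    (h : GenRep ε K E F) ⦃x y : Fr n⦄ (hxy : GenRel ε x y) :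
    evalFr K E F x = evalFr K E F y := by
  cases hxy with
  | K_zero => simpa using h.weight.zero
  | K_add μ ν => simpa using h.weight.add μ ν
  | K_E μ i => simpa using (h.weight.conj_iff μ _ _).2 (h.K_E μ i)
  | K_F μ i => simpa using (h.weight.conj_iff μ _ _).2 (h.K_F μ i)
  | E_F i j =>
    have := h.E_F i j
    split_ifs at this ⊢ <;> simpa using this
  | E_sq i hi => simpa using h.serreE.sq i hi
  | F_sq i hi => simpa using h.serreF.sq i hi
  | E_comm i j h1 h2 => simpa [map_qbr] using h.serreE.comm i j h1 h2
  | F_comm i j h1 h2 => simpa [map_qbr] using h.serreF.comm i j h1 h2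
  | E_cubic i j hi hij => simpa [map_cubic] using h.serreE.cubic i j hi hij
  | F_cubic i j hi hij => simpa [map_cubic] using h.serreF.cubic i j hi hij
  | E_quartic i hi => simpa [map_quartic] using h.serreE.quartic i hi
  | F_quartic i hi => simpa [map_quartic] using h.serreF.quartic i hi

theorem SuperRep.eval_eq {ε : ZMod n → Fin 2} {K : Wt n → B} {E F : ZMod n → B}
    (h : SuperRep ε K E F) ⦃x y : Fr n⦄ (hxy : SuperRel ε x y) :
    evalFr K E F x = evalFr K E F y := by
  cases hxy with
  | K_zero => simpa using h.weight.zero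
  | K_add μ ν => simpa using h.weight.add μ ν
  | K_E μ i => simpa using (h.weight.conj_iff μ _ _).2 (h.K_E μ i)
  | K_F μ i =>
    have := (h.weight.conj_iff μ _ _).2 (h.K_F μ i)
    simpa only [map_mul, map_smul, evalFr_K, evalFr_F] using this
  | E_F i j =>
    have := h.E_F i j
    split_ifs at this ⊢ <;> simpa using this
  | E_sq i hi => simpa using h.serreE.sq i hi
  | F_sq i hi => simpa using h.serreF.sq i hi
  | E_comm i j h1 h2 => simpa [map_qbr] using h.serreE.comm i j h1 h2
  | F_comm i j h1 h2 => simpa [map_qbr] using h.serreF.comm i j h1 h2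
  | E_cubic i j hi hij => simpa [map_cubic] using h.serreE.cubic i j hi hij
  | F_cubic i j hi hij => simpa [map_cubic] using h.serreF.cubic i j hi hij
  | E_quartic i hi => simpa [map_superSerre] using h.serreE.quartic i hi
  | F_quartic i hi => simpa [map_superSerre] using h.serreF.quartic i hi

theorem genRep_of_hom {ε : ZMod n → Fin 2} (φ : UGen ε →ₐ[Kq] B) :
    GenRep ε (fun μ => φ (mkG ε (fK μ))) (fun i => φ (mkG ε (fE i)))
      (fun i => φ (mkG ε (fF i))) := by
  have key : ∀ {x y}, GenRel ε x y → φ (mkG ε x) = φ (mkG ε y) :=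
    fun h => congrArg φ (mkG_rel h)
  have hw : WeightHom fun μ => φ (mkG ε (fK μ)) :=
    ⟨by simpa using key GenRel.K_zero, fun μ ν => by simpa using key (GenRel.K_add μ ν)⟩
  refine ⟨hw, fun μ i => (hw.conj_iff μ _ _).1 ?_, fun μ i => (hw.conj_iff μ _ _).1 ?_,
    fun i j => ?_, ⟨fun i hi => ?_, fun i j h1 h2 => ?_, fun i j hi h => ?_, fun i hi => ?_⟩,
    ⟨fun i hi => ?_, fun i j h1 h2 => ?_, fun i j hi h => ?_, fun i hi => ?_⟩⟩
  · simpa using key (GenRel.K_E μ i)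
  · simpa using key (GenRel.K_F μ i)
  · have := key (GenRel.E_F (ε := ε) i j)
    split_ifs at this ⊢ <;> simpa using this
  · simpa using key (GenRel.E_sq i hi)
  · simpa [map_qbr] using key (GenRel.E_comm (ε := ε) i j h1 h2)
  · simpa [map_cubic] using key (GenRel.E_cubic i j hi h)
  · simpa [map_quartic] using key (GenRel.E_quartic i hi)
  · simpa using key (GenRel.F_sq i hi)
  · simpa [map_qbr] using key (GenRel.F_comm (ε := ε) i j h1 h2)
  · simpa [map_cubic] using key (GenRel.F_cubic i j hi h)
  · simpa [map_quartic] using key (GenRel.F_quartic i hi)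

theorem superRep_of_hom {ε : ZMod n → Fin 2} (φ : USuper ε →ₐ[Kq] B) :
    SuperRep ε (fun μ => φ (mkS ε (fK μ))) (fun i => φ (mkS ε (fE i)))
      (fun i => φ (mkS ε (fF i))) := by
  have key : ∀ {x y}, SuperRel ε x y → φ (mkS ε x) = φ (mkS ε y) :=
    fun h => congrArg φ (mkS_rel h)
  have hw : WeightHom fun μ => φ (mkS ε (fK μ)) :=
    ⟨by simpa using key SuperRel.K_zero, fun μ ν => by simpa using key (SuperRel.K_add μ ν)⟩
  refine ⟨hw, fun μ i => (hw.conj_iff μ _ _).1 ?_, fun μ i => (hw.conj_iff μ _ _).1 ?_,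
    fun i j => ?_, ⟨fun i hi => ?_, fun i j h1 h2 => ?_, fun i j hi h => ?_, fun i hi => ?_⟩,
    ⟨fun i hi => ?_, fun i j h1 h2 => ?_, fun i j hi h => ?_, fun i hi => ?_⟩⟩
  · simpa using key (SuperRel.K_E μ i)
  · simpa only [map_mul, map_smul] using key (SuperRel.K_F μ i)
  · have := key (SuperRel.E_F (ε := ε) i j)
    split_ifs at this ⊢ <;> simpa using this
  · simpa using key (SuperRel.E_sq i hi)
  · simpa [map_qbr] using key (SuperRel.E_comm (ε := ε) i j h1 h2)
  · simpa [map_cubic] using key (SuperRel.E_cubic i j hi h)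
  · simpa [map_superSerre] using key (SuperRel.E_quartic i hi)
  · simpa using key (SuperRel.F_sq i hi)
  · simpa [map_qbr] using key (SuperRel.F_comm (ε := ε) i j h1 h2)
  · simpa [map_cubic] using key (SuperRel.F_cubic i j hi h)
  · simpa [map_superSerre] using key (SuperRel.F_quartic i hi)

/-- A homomorphism from the group `Sig n` acting on given elements by the prescribed signs. -/
structure Equivariant (ε : ZMod n → Fin 2) (S : Sig n →* B) (K : Wt n → B) (E F : ZMod n → B) :
    Prop where
  S_K : ∀ g μ, S g * K μ = K μ * S g
  S_E : ∀ g i, S g * E i = chik ε g i • (E i * S g)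
  S_F : ∀ g i, S g * F i = chik ε g i • (F i * S g)

/-- This covariance is what allows a homomorphism on the coefficient algebra and one on the group to
be glued to a homomorphism on the skew group algebra. -/
theorem Equivariant.eval_signFr {ε : ZMod n → Fin 2} {S : Sig n →* B} {K : Wt n → B}
    {E F : ZMod n → B} (h : Equivariant ε S K E F) (g : Sig n) (x : Fr n) :
    evalFr K E F (signFr ε g x) * S g = S g * evalFr K E F x := by
  induction x using FreeAlgebra.induction with
  | grade0 r => simp [Algebra.commutes]
  | grade1 x =>
    cases x with
    | K μ =>
      change evalFr K E F (signFr ε g (fK μ)) * S g = S g * evalFr K E F (fK μ)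
      simp [h.S_K]
    | E i =>
      change evalFr K E F (signFr ε g (fE i)) * S g = S g * evalFr K E F (fE i)
      simp [h.S_E]
    | F i =>
      change evalFr K E F (signFr ε g (fF i)) * S g = S g * evalFr K E F (fF i)
      simp [h.S_F]
  | mul a b ha hb => rw [map_mul, map_mul, mul_assoc, hb, ← mul_assoc, ha, map_mul, mul_assoc]
  | add a b ha hb => simp only [map_add, add_mul, mul_add, ha, hb]

/-- The homomorphism from the extended generalized quantum group defined by a representation. -/
theorem exists_hom_UGenSig {ε : ZMod n → Fin 2} {S : Sig n →* B} {K : Wt n → B}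
    {E F : ZMod n → B} (h : GenRep ε K E F) (hS : Equivariant ε S K E F) :
    ∃ φ : UGenSig ε →ₐ[Kq] B, (∀ μ, φ (gK ε μ) = K μ) ∧ (∀ i, φ (gE ε i) = E i) ∧
      (∀ i, φ (gF ε i) = F i) ∧ ∀ g, φ (gS ε g) = S g := by
  let f : UGen ε →ₐ[Kq] B := RingQuot.liftAlgHom Kq ⟨evalFr K E F, h.eval_eq⟩
  have hf : ∀ x, f (mkG ε x) = evalFr K E F x := fun x =>
    RingQuot.liftAlgHom_mkAlgHom_apply Kq (evalFr K E F) h.eval_eq x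
  have hc : ∀ {x : UGen ε} {g : Sig n}, f (g • x) * S g = S g * f x := by
    intro x g
    obtain ⟨y, rfl⟩ := mkG_surjective ε x
    change f (actG ε g (mkG ε y)) * S g = _
    rw [actG_mk, hf, hf, hS.eval_signFr]
  have hs : ∀ g x, SkewMonoidAlgebra.liftNCAlgHom f S hc (SkewMonoidAlgebra.single g x) =
      f x * S g := fun g x => SkewMonoidAlgebra.liftNC_single _ _ _ _
  refine ⟨SkewMonoidAlgebra.liftNCAlgHom f S hc, fun μ => ?_, fun i => ?_, fun i => ?_,
    fun g => ?_⟩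
  · rw [gK, hs, hf, evalFr_K, map_one, mul_one]
  · rw [gE, hs, hf, evalFr_E, map_one, mul_one]
  · rw [gF, hs, hf, evalFr_F, map_one, mul_one]
  · rw [gS, SkewMonoidAlgebra.of_apply, hs, map_one, one_mul]

/-- The homomorphism from the extended quantum affine superalgebra defined by a representation. -/
theorem exists_hom_USuperSig {ε : ZMod n → Fin 2} {S : Sig n →* B} {K : Wt n → B}
    {E F : ZMod n → B} (h : SuperRep ε K E F) (hS : Equivariant ε S K E F) :
    ∃ φ : USuperSig ε →ₐ[Kq] B, (∀ μ, φ (sK ε μ) = K μ) ∧ (∀ i, φ (sE ε i) = E i) ∧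
      (∀ i, φ (sF ε i) = F i) ∧ ∀ g, φ (sS ε g) = S g := by
  let f : USuper ε →ₐ[Kq] B := RingQuot.liftAlgHom Kq ⟨evalFr K E F, h.eval_eq⟩
  have hf : ∀ x, f (mkS ε x) = evalFr K E F x := fun x =>
    RingQuot.liftAlgHom_mkAlgHom_apply Kq (evalFr K E F) h.eval_eq x
  have hc : ∀ {x : USuper ε} {g : Sig n}, f (g • x) * S g = S g * f x := by
    intro x g
    obtain ⟨y, rfl⟩ := mkS_surjective ε x
    change f (actS ε g (mkS ε y)) * S g = _
    rw [actS_mk, hf, hf, hS.eval_signFr]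
  have hs : ∀ g x, SkewMonoidAlgebra.liftNCAlgHom f S hc (SkewMonoidAlgebra.single g x) =
      f x * S g := fun g x => SkewMonoidAlgebra.liftNC_single _ _ _ _
  refine ⟨SkewMonoidAlgebra.liftNCAlgHom f S hc, fun μ => ?_, fun i => ?_, fun i => ?_,
    fun g => ?_⟩
  · rw [sK, hs, hf, evalFr_K, map_one, mul_one]
  · rw [sE, hs, hf, evalFr_E, map_one, mul_one]
  · rw [sF, hs, hf, evalFr_F, map_one, mul_one]
  · rw [sS, SkewMonoidAlgebra.of_apply, hs, map_one, one_mul]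

end Rep

/-! ### The extended algebras as representations -/

/-- The inclusion of the coefficient algebra in a skew monoid algebra. -/
def skewIncl (A G : Type*) [Ring A] [Algebra Kq A] [Monoid G] [MulSemiringAction G A]
    [SMulCommClass G Kq A] : A →ₐ[Kq] SkewMonoidAlgebra A G where
  __ := SkewMonoidAlgebra.singleOneRingHom
  commutes' _ := rfl

theorem genRep_UGenSig (ε : ZMod n → Fin 2) : GenRep ε (gK ε) (gE ε) (gF ε) :=
  genRep_of_hom (skewIncl (UGen ε) (Sig n))

theorem superRep_USuperSig (ε : ZMod n → Fin 2) : SuperRep ε (sK ε) (sE ε) (sF ε) :=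
  superRep_of_hom (skewIncl (USuper ε) (Sig n))

theorem equivariant_UGenSig (ε : ZMod n → Fin 2) :
    Equivariant ε (gS ε) (gK ε) (gE ε) (gF ε) := by
  have h : ∀ (g : Sig n) (x : Fr n), gS ε g * SkewMonoidAlgebra.single 1 (mkG ε x) =
      SkewMonoidAlgebra.single 1 (mkG ε (signFr ε g x)) * gS ε g := by
    intro g x
    rw [← actG_mk, gS, SkewMonoidAlgebra.of_apply, SkewMonoidAlgebra.single_mul_single,
      SkewMonoidAlgebra.single_mul_single]
    simp
    rfl
  refine ⟨fun g μ => ?_, fun g i => ?_, fun g i => ?_⟩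
  · rw [gK, h, signFr_K]
  · rw [gE, h, signFr_E, map_smul, ← SkewMonoidAlgebra.smul_single, smul_mul_assoc]
  · rw [gF, h, signFr_F, map_smul, ← SkewMonoidAlgebra.smul_single, smul_mul_assoc]

theorem equivariant_USuperSig (ε : ZMod n → Fin 2) :
    Equivariant ε (sS ε) (sK ε) (sE ε) (sF ε) := by
  have h : ∀ (g : Sig n) (x : Fr n), sS ε g * SkewMonoidAlgebra.single 1 (mkS ε x) =
      SkewMonoidAlgebra.single 1 (mkS ε (signFr ε g x)) * sS ε g := by
    intro g x
    rw [← actS_mk, sS, SkewMonoidAlgebra.of_apply, SkewMonoidAlgebra.single_mul_single,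
      SkewMonoidAlgebra.single_mul_single]
    simp
    rfl
  refine ⟨fun g μ => ?_, fun g i => ?_, fun g i => ?_⟩
  · rw [sK, h, signFr_K]
  · rw [sE, h, signFr_E, map_smul, ← SkewMonoidAlgebra.smul_single, smul_mul_assoc]
  · rw [sF, h, signFr_F, map_smul, ← SkewMonoidAlgebra.smul_single, smul_mul_assoc]

/-- Other algebra structures over ℕ and ℤ on rational functions can be reached through the
coefficients; the high priority selects the canonical ones for the scalar computations below. -/
instance (priority := 2000) natAlgebraKq : Algebra ℕ Kq := Semiring.toNatAlgebra

instance (priority := 2000) intAlgebraKq : Algebra ℤ Kq := Ring.toIntAlgebra _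

/-! ### Odd and even simple roots -/

theorem form_root_self (hn : 4 ≤ n) (ε : ZMod n → Fin 2) (i : ZMod n) :
    form ε (root i) (root i) = (-1) ^ (ε i : ℕ) + (-1) ^ (ε (i + 1) : ℕ) := by
  rw [form_root]
  have := self_ne_succ hn i
  simp [root, this, this.symm]

theorem isOdd_iff (hn : 4 ≤ n) (ε : ZMod n → Fin 2) (i : ZMod n) :
    IsOdd ε i ↔ ε i ≠ ε (i + 1) := by
  rw [IsOdd, form_root_self hn]
  rcases eq_zero_or_one (ε i) with h | h <;> rcases eq_zero_or_one (ε (i + 1)) with h' | h' <;>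
    simp [h, h']

theorem isEven_iff (hn : 4 ≤ n) (ε : ZMod n → Fin 2) (i : ZMod n) :
    IsEven ε i ↔ ε i = ε (i + 1) := by
  rw [IsEven, form_root_self hn]
  rcases eq_zero_or_one (ε i) with h | h <;> rcases eq_zero_or_one (ε (i + 1)) with h' | h' <;>
    simp [h, h']

theorem neg_one_pow_par_of_isEven (hn : 4 ≤ n) {ε : ZMod n → Fin 2} {i : ZMod n}
    (hi : IsEven ε i) : (-1 : ℤˣ) ^ par ε i = 1 := by
  rw [isEven_iff hn] at hi
  rw [par, ← hi, ← two_mul, pow_mul]; simp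

/-! ### Twisting the Serre relations -/

section Twist

variable {B : Type*} [Ring B] [Algebra Kq B]

/-- The sign condition on group elements `w_i` under which multiplication of `x_i` by `w_i` turns
the relations of the generalized quantum group into those of the quantum affine superalgebra. -/
def TwistSign (ε : ZMod n → Fin 2) (w : ZMod n → Sig n) : Prop :=
  ∀ i j, i ≠ j → chi ε j (w i) * chi ε i (w j) = (-1) ^ (par ε i * par ε j) * adjSign ε i j

theorem twistSign_twE (hn : 4 ≤ n) {ε : ZMod n → Fin 2} (hε : ε 1 = 0) :
    TwistSign ε (twE ε) := fun _ _ hij => chi_twE_mul hn hε hij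

theorem chi_twK_eq (hn : 4 ≤ n) (ε : ZMod n → Fin 2) {i j : ZMod n} (hij : i ≠ j) :
    chi ε j (twK ε i) = adjSign ε i j := chi_twK hn ε hij

theorem twistSign_twF (hn : 4 ≤ n) {ε : ZMod n → Fin 2} (hε : ε 1 = 0) :
    TwistSign ε (twF ε) := by
  intro i j hij
  rw [twF, twF, map_mul, map_mul, mul_mul_mul_comm, chi_twE_mul hn hε hij, chi_twK_eq hn ε hij,
    chi_twK_eq hn ε hij.symm, adjSign_comm ε j i, Int.units_mul_self, mul_one]

theorem TwistSign.chik_eq {ε : ZMod n → Fin 2} {w : ZMod n → Sig n} (hw : TwistSign ε w)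
    {i j : ZMod n} (hij : i ≠ j) : chik ε (w i) j * chik ε (w j) i =
      (-1) ^ (par ε i * par ε j) * ((adjSign ε i j : ℤ) : Kq) := by
  have := congrArg (fun u : ℤˣ => ((u : ℤ) : Kq)) (hw i j hij)
  simpa [QSuper.chik] using this

/-- The nested bracket has eight monomials, two of which contain y'y' = 0. Each of the remaining six
equals the untwisted monomial times the common factor `u`, up to the common sign `l` and the
exchange signs s₁, s₂, s₃ of the pairs (x, y), (y, z), (x, z). Since x and z commute, yzxy and yxzy
merge, and their coefficients q and q⁻¹ add up to ±[2]. -/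
theorem quartic_twist {x y z x' y' z' u : B} {l s₁ s₂ s₃ : Kq}
    (h₁ : y' * x' * y' * z' = (l * s₁) • (y * x * y * z * u))
    (h₂ : y' * z' * y' * x' = (l * (s₂ * s₃)) • (y * z * y * x * u))
    (h₃ : x' * y' * z' * y' = (l * s₂) • (x * y * z * y * u))
    (h₄ : z' * y' * x' * y' = (l * (s₁ * s₃)) • (z * y * x * y * u))
    (h₅ : y' * x' * z' * y' = (l * (s₁ * s₂)) • (y * x * z * y * u))
    (h₆ : y' * z' * x' * y' = (l * (s₁ * s₂ * s₃)) • (y * z * x * y * u))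
    (hyy : y' * y' = 0) (hxz : x * z = z * x) (ε : ZMod n → Fin 2) (i : ZMod n)
    (hi : ε i ≠ ε (i + 1))
    (hs₁ : s₁ = (-1) ^ (par ε (i - 1) * par ε i) * (-1) ^ (ε i : ℕ))
    (hs₂ : s₂ = (-1) ^ (par ε i * par ε (i + 1)) * (-1) ^ (ε (i + 1) : ℕ))
    (hs₃ : s₃ = (-1) ^ (par ε (i - 1) * par ε (i + 1))) :
    superSerre ε i x' y' z' = (l * s₁) • (quartic ((-1) ^ (ε i : ℕ) * two) x y z * u) := by
  have e₁ : ∀ a b c : Kq, qbr c y' (qbr (b * q⁻¹) (qbr (a * q) x' y') z') =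
      y' * x' * y' * z' - (b * q⁻¹) • (y' * z' * x' * y') + (a * b) • (y' * z' * y' * x')
        - c • (x' * y' * z' * y') + (c * a * q) • (y' * x' * z' * y')
        - (c * a * b) • (z' * y' * x' * y') := by
    intro a b c
    have k₁ : y' * (y' * (x' * z')) = 0 := by rw [← mul_assoc, hyy, zero_mul]
    simp only [qbr, mul_sub, sub_mul, smul_mul_assoc, mul_smul_comm, smul_sub, smul_smul,
      mul_assoc, hyy, k₁, mul_zero, smul_zero]
    match_scalars <;> field_simp [q_ne_zero]
  have k₂ : y * z * x * y = y * x * z * y := by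
    rw [mul_assoc y z x, ← hxz, mul_assoc y x z]
  rw [superSerre, e₁, h₁, h₂, h₃, h₄, h₅, h₆, k₂, quartic, two_eq]
  simp only [sub_mul, add_mul, smul_mul_assoc]
  rw [hs₁, hs₂, hs₃]
  have hp : par ε (i - 1) = (ε (i - 1) : ℕ) + (ε i : ℕ) := by rw [par, sub_add_cancel]
  rw [hp, par, par]
  -- All signs depend only on the parities of the four consecutive indices i - 1, ..., i + 2; the
  -- cases with ε_i = ε_{i+1} contradict oddness.
  rcases eq_zero_or_one (ε (i - 1)) with h0 | h0 <;>
  rcases eq_zero_or_one (ε i) with h1 | h1 <;>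
  rcases eq_zero_or_one (ε (i + 1)) with h2 | h2 <;>
  rcases eq_zero_or_one (ε (i + 1 + 1)) with h3 | h3 <;>
  first
  | exact absurd (h1.trans h2.symm) hi
  | (simp only [h0, h1, h2, h3, Fin.val_zero, Fin.val_one]
     match_scalars <;> ring)

variable {ε : ZMod n → Fin 2} {S : Sig n →* B} {X : ZMod n → B} {w : ZMod n → Sig n}

theorem twist_mul (hS : ∀ g i, S g * X i = chik ε g i • (X i * S g)) (m : B) (u v : Sig n)
    (j : ZMod n) : m * S u * (X j * S v) = chik ε u j • (m * X j * S (u * v)) := by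
  rw [mul_assoc, ← mul_assoc (S u), hS, smul_mul_assoc, mul_smul_comm, map_mul]
  simp only [mul_assoc]

theorem S_mul_eq_zero_iff (S : Sig n →* B) (x : B) (g : Sig n) : x * S g = 0 ↔ x = 0 := by
  refine ⟨fun h => ?_, fun h => by rw [h, zero_mul]⟩
  rw [← mul_one x, ← map_one S, ← Sig.mul_self g, map_mul, ← mul_assoc, h, zero_mul]

theorem chik_ne_zero (ε : ZMod n → Fin 2) (g : Sig n) (i : ZMod n) : chik ε g i ≠ 0 :=
  left_ne_zero_of_mul_eq_one (chik_mul_self ε g i)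

theorem sq_twist_iff (hS : ∀ g i, S g * X i = chik ε g i • (X i * S g)) (i : ZMod n) :
    (X i * S (w i)) ^ 2 = 0 ↔ X i ^ 2 = 0 := by
  rw [pow_two, twist_mul hS, smul_eq_zero_iff_right (chik_ne_zero _ _ _), S_mul_eq_zero_iff,
    pow_two]

theorem sub_ne_of_adj (hn : 4 ≤ n) {i j : ZMod n} (h : i - j = 1 ∨ i - j = -1) : i ≠ j := by
  rintro rfl
  rw [sub_self] at h
  rcases h with h | h
  · exact one_ne_zero' hn h.symm
  · exact one_ne_zero' hn (by linear_combination h)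

theorem adjSign_of_not_adj {i j : ZMod n} (h1 : i - j ≠ 1) (h2 : i - j ≠ -1) :
    adjSign ε i j = 1 := by
  rw [adjSign, if_neg, if_neg, mul_one]
  · exact fun h => h1 (by rw [h]; ring)
  · exact fun h => h2 (by rw [h]; ring)

theorem adjSign_succ (hn : 4 ≤ n) (ε : ZMod n → Fin 2) (i : ZMod n) :
    adjSign ε i (i + 1) = (-1) ^ (ε (i + 1) : ℕ) := by
  rw [adjSign, if_pos rfl, if_neg, mul_one]
  exact fun h => two_ne_zero' hn (by linear_combination -h)

theorem adjSign_of_isEven (hn : 4 ≤ n) {i j : ZMod n} (hi : IsEven ε i)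
    (h : i - j = 1 ∨ i - j = -1) : adjSign ε i j = (-1) ^ (ε i : ℕ) := by
  rcases h with h | h
  · obtain rfl : i = j + 1 := by rw [← h]; ring
    rw [adjSign_comm, adjSign_succ hn]
  · obtain rfl : j = i + 1 := by linear_combination -h
    rw [adjSign_succ hn, ← (isEven_iff hn ε i).1 hi]

/-- For non-adjacent indices the adjacency sign is 1, so the exchange sign is exactly the
supercommutation sign. -/
theorem comm_twist_iff (hS : ∀ g i, S g * X i = chik ε g i • (X i * S g)) (hw : TwistSign ε w)
    {i j : ZMod n} (hij : i ≠ j) (h1 : i - j ≠ 1) (h2 : i - j ≠ -1) :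
    qbr ((-1) ^ (par ε i * par ε j)) (X i * S (w i)) (X j * S (w j)) = 0 ↔
      qbr 1 (X i) (X j) = 0 := by
  have h := hw.chik_eq hij
  rw [adjSign_of_not_adj h1 h2] at h
  have h3 := chik_mul_self ε (w j) i
  have h4 := chik_mul_self ε (w i) j
  have : qbr ((-1) ^ (par ε i * par ε j)) (X i * S (w i)) (X j * S (w j)) =
      chik ε (w i) j • (qbr 1 (X i) (X j) * S (w i * w j)) := by
    rw [qbr, qbr, twist_mul hS, twist_mul hS, mul_comm (w j), sub_mul, smul_mul_assoc]
    have h5 : (-1) ^ (par ε i * par ε j) * chik ε (w j) i = chik ε (w i) j := by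
      simp only [Units.val_one, Int.cast_one, mul_one] at h
      rw [← h, mul_assoc, h3, mul_one]
    rw [smul_smul, h5, one_smul, smul_sub]
  rw [this, smul_eq_zero_iff_right (chik_ne_zero _ _ _), S_mul_eq_zero_iff]

/-- For even i the exponent p(i) is even, so the exchange sign reduces to (-1)^{ε_i}. It enters the
middle monomial relative to the outer two and accounts for the discrepancy between the two cubic
coefficients. -/
theorem cubic_twist_iff (hn : 4 ≤ n) (hS : ∀ g i, S g * X i = chik ε g i • (X i * S g))
    (hw : TwistSign ε w) {i j : ZMod n} (hi : IsEven ε i) (hij : i - j = 1 ∨ i - j = -1) :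
    cubic two (X i * S (w i)) (X j * S (w j)) = 0 ↔
      cubic ((-1) ^ (ε i : ℕ) * two) (X i) (X j) = 0 := by
  have h := hw.chik_eq (sub_ne_of_adj hn hij)
  rw [adjSign_of_isEven hn hi hij, pow_mul] at h
  have hp := congrArg (fun u : ℤˣ => ((u : ℤ) : Kq)) (neg_one_pow_par_of_isEven hn hi)
  simp only [Units.val_pow_eq_pow_val, Units.val_neg, Units.val_one, Int.cast_pow, Int.cast_neg,
    Int.cast_one] at hp h
  rw [hp, one_pow, one_mul] at h
  have h3 := chik_mul_self ε (w j) i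
  have h4 := chik_mul_self ε (w i) j
  have : cubic two (X i * S (w i)) (X j * S (w j)) =
      chik ε (w i) i • (cubic ((-1) ^ (ε i : ℕ) * two) (X i) (X j) * S (w j)) := by
    have e₁ : w i * w i * w j = w j := by rw [Sig.mul_self, one_mul]
    have e₂ : w i * w j * w i = w j := by rw [mul_right_comm, Sig.mul_self, one_mul]
    have e₃ : w j * w i * w i = w j := by rw [mul_assoc, Sig.mul_self, mul_one]
    rw [cubic, pow_two, ← mul_assoc (X j * S (w j))]
    simp only [cubic, pow_two, twist_mul hS, smul_mul_assoc, e₁, e₂, e₃, smul_smul,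
      chik_mul, sub_mul, add_mul]
    simp only [← mul_assoc]
    rw [← h]
    match_scalars
    · linear_combination chik ε (w i) i * h4
    · ring
    · linear_combination chik ε (w i) i * h3
  rw [this, smul_eq_zero_iff_right (chik_ne_zero _ _ _), S_mul_eq_zero_iff]

theorem quartic_twist_iff (hn : 4 ≤ n) (hS : ∀ g i, S g * X i = chik ε g i • (X i * S g))
    (hw : TwistSign ε w) {i : ZMod n} (hi : IsOdd ε i) (hyy : X i ^ 2 = 0)
    (hxz : qbr 1 (X (i - 1)) (X (i + 1)) = 0) :
    superSerre ε i (X (i - 1) * S (w (i - 1))) (X i * S (w i)) (X (i + 1) * S (w (i + 1))) = 0 ↔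
      quartic ((-1) ^ (ε i : ℕ) * two) (X (i - 1)) (X i) (X (i + 1)) = 0 := by
  have nxy : i - 1 ≠ i := sub_ne_of_adj hn (Or.inr (by ring))
  have nyz : i ≠ i + 1 := self_ne_succ hn i
  have nxz : i - 1 ≠ i + 1 := fun h => two_ne_zero' hn (by linear_combination -h)
  have a₁ := hw.chik_eq nxy
  have a₂ := hw.chik_eq nyz
  have a₃ := hw.chik_eq nxz
  have b₁ : adjSign ε (i - 1) i = (-1) ^ (ε i : ℕ) := by
    have := adjSign_succ hn ε (i - 1)
    rwa [sub_add_cancel] at this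
  rw [b₁] at a₁
  rw [adjSign_succ hn] at a₂
  rw [adjSign_of_not_adj (fun h => three_ne_zero' hn (by linear_combination -h))
    (fun h => one_ne_zero' hn (by linear_combination -h))] at a₃
  simp only [Units.val_pow_eq_pow_val, Units.val_neg, Units.val_one, Int.cast_pow, Int.cast_neg,
    Int.cast_one, mul_one] at a₁ a₂ a₃
  have hyy' := (sq_twist_iff (w := w) hS i).2 hyy
  rw [pow_two] at hyy'
  rw [qbr, one_smul, sub_eq_zero] at hxz
  generalize hx : i - 1 = x at *
  generalize hz : i + 1 = z at *
  have c₁ := chik_mul_self ε (w x) i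
  have c₂ := chik_mul_self ε (w x) z
  have c₃ := chik_mul_self ε (w i) x
  have c₄ := chik_mul_self ε (w i) z
  have c₅ := chik_mul_self ε (w z) x
  have c₆ := chik_mul_self ε (w z) i
  -- In every monomial of the quartic relation the middle generator occurs twice, so its group
  -- element cancels and all monomials share the same group factor.
  have e : ∀ a b c : Sig n, a * b * a * c = b * c ∧ a * b * c * a = b * c ∧
      b * a * c * a = b * c := by
    intro a b c
    refine ⟨?_, ?_, ?_⟩
    · rw [mul_right_comm a b a, Sig.mul_self, one_mul]
    · rw [mul_assoc a b c, mul_right_comm, Sig.mul_self, one_mul]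
    · rw [mul_right_comm b a c, mul_assoc, Sig.mul_self, mul_one]
  have e₁ := (e (w i) (w x) (w z)).1
  have e₂ := (e (w i) (w z) (w x)).1
  have e₃ := (e (w i) (w x) (w z)).2.2
  have e₄ := (e (w i) (w z) (w x)).2.2
  have e₅ := (e (w i) (w x) (w z)).2.1
  have e₆ := (e (w i) (w z) (w x)).2.1
  rw [mul_comm (w z) (w x)] at e₂ e₄ e₆
  -- The scalar `l` gathers the signs common to all six monomials; a₁, a₂, a₃ evaluate the exchange
  -- signs.
  have key := quartic_twist (x := X x) (y := X i) (z := X z)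
    (x' := X x * S (w x)) (y' := X i * S (w i)) (z' := X z * S (w z)) (u := S (w x * w z))
    (l := chik ε (w i) i * chik ε (w x) z)
    (s₁ := chik ε (w x) i * chik ε (w i) x) (s₂ := chik ε (w i) z * chik ε (w z) i)
    (s₃ := chik ε (w x) z * chik ε (w z) x)
    (by simp only [twist_mul hS, smul_mul_assoc, smul_smul, chik_mul, e₁]; congr 1; grind)
    (by simp only [twist_mul hS, smul_mul_assoc, smul_smul, chik_mul, e₂]; congr 1; grind)
    (by simp only [twist_mul hS, smul_mul_assoc, smul_smul, chik_mul, e₃]; congr 1; grind)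
    (by simp only [twist_mul hS, smul_mul_assoc, smul_smul, chik_mul, e₄]; congr 1; grind)
    (by simp only [twist_mul hS, smul_mul_assoc, smul_smul, chik_mul, e₅]; congr 1; grind)
    (by simp only [twist_mul hS, smul_mul_assoc, smul_smul, chik_mul, e₆]; congr 1; grind)
    hyy' hxz ε i ((isOdd_iff hn ε i).1 hi) (by rw [hx, a₁]) (by rw [hz, a₂])
    (by rw [hx, hz, a₃])
  rw [key, smul_eq_zero_iff_right, S_mul_eq_zero_iff]
  simp [chik_ne_zero]

theorem superSerre_twist_iff (hn : 4 ≤ n) (hS : ∀ g i, S g * X i = chik ε g i • (X i * S g))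
    (hw : TwistSign ε w) : SuperSerre ε (fun i => X i * S (w i)) ↔ GenSerre ε X := by
  have nadj : ∀ i : ZMod n, i - 1 - (i + 1) ≠ 1 ∧ i - 1 - (i + 1) ≠ -1 := fun i =>
    ⟨fun h => three_ne_zero' hn (by linear_combination -h),
      fun h => one_ne_zero' hn (by linear_combination -h)⟩
  have nxz : ∀ i : ZMod n, i - 1 ≠ i + 1 := fun i h => two_ne_zero' hn (by linear_combination -h)
  constructor
  · intro h
    have sq : ∀ i, IsOdd ε i → X i ^ 2 = 0 := fun i hi => (sq_twist_iff hS i).1 (h.sq i hi)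
    have comm : ∀ i j, i - j ≠ 1 → i - j ≠ -1 → qbr 1 (X i) (X j) = 0 := by
      intro i j h1 h2
      by_cases hij : i = j
      · subst hij; simp [qbr]
      · exact (comm_twist_iff hS hw hij h1 h2).1 (h.comm i j h1 h2)
    exact ⟨sq, comm, fun i j hi hij => (cubic_twist_iff hn hS hw hi hij).1 (h.cubic i j hi hij),
      fun i hi => (quartic_twist_iff hn hS hw hi (sq i hi)
        (comm _ _ (nadj i).1 (nadj i).2)).1 (h.quartic i hi)⟩
  · intro h
    have sq : ∀ i, IsOdd ε i → (X i * S (w i)) ^ 2 = 0 :=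
      fun i hi => (sq_twist_iff hS i).2 (h.sq i hi)
    refine ⟨sq, ?_, fun i j hi hij => (cubic_twist_iff hn hS hw hi hij).2 (h.cubic i j hi hij),
      fun i hi => (quartic_twist_iff hn hS hw hi (h.sq i hi)
        (h.comm _ _ (nadj i).1 (nadj i).2)).2 (h.quartic i hi)⟩
    intro i j h1 h2
    by_cases hij : i = j
    · subst hij
      by_cases hi : IsOdd ε i
      · rw [qbr, ← pow_two, sq i hi]; simp
      · have hi' : IsEven ε i := by
          rw [isEven_iff hn]; rw [isOdd_iff hn] at hi; exact not_not.1 hi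
        have hp := congrArg (fun u : ℤˣ => ((u : ℤ) : Kq)) (neg_one_pow_par_of_isEven hn hi')
        simp only [Units.val_pow_eq_pow_val, Units.val_neg, Units.val_one, Int.cast_pow,
          Int.cast_neg, Int.cast_one] at hp
        rw [qbr, pow_mul, hp, one_pow, one_smul, sub_self]
    · exact (comm_twist_iff hS hw hij h1 h2).2 (h.comm i j h1 h2)

end Twist

/-! ### Twisting the full presentations -/

theorem IsWeightTwist.s_neg {ε : ZMod n → Fin 2} {s : Wt n → Sig n} {c : Wt n → ℤˣ}
    (h : IsWeightTwist ε s c) (μ : Wt n) : s (-μ) = s μ := by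
  have := h.s_add (-μ) μ
  rw [neg_add_cancel, h.s_zero] at this
  rw [← mul_one (s (-μ)), ← Sig.mul_self (s μ), ← mul_assoc, ← this, one_mul]

theorem IsWeightTwist.c_neg {ε : ZMod n → Fin 2} {s : Wt n → Sig n} {c : Wt n → ℤˣ}
    (h : IsWeightTwist ε s c) (μ : Wt n) : c (-μ) = c μ := by
  have := h.c_add (-μ) μ
  rw [neg_add_cancel, h.c_zero] at this
  rw [← mul_one (c (-μ)), ← Int.units_mul_self (c μ), ← mul_assoc, ← this, one_mul]

/-- The image of a sign in the ground field. -/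
def usign : ℤˣ →* Kq := (Int.castRingHom Kq).toMonoidHom.comp (Units.coeHom ℤ)

theorem usign_mul_self (u : ℤˣ) : usign u * usign u = 1 := by
  rw [← map_mul, Int.units_mul_self, map_one]

theorem usign_ne_zero (u : ℤˣ) : usign u ≠ 0 := left_ne_zero_of_mul_eq_one (usign_mul_self u)

theorem chik_eq_usign (ε : ZMod n → Fin 2) (g : Sig n) (i : ZMod n) :
    chik ε g i = usign (chi ε i g) := rfl

theorem usign_neg_one_pow (m : ℕ) : usign ((-1) ^ m) = (-1) ^ m := by
  rw [map_pow]; simp [usign]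

section Twist

variable {B : Type*} [Ring B] [Algebra Kq B] {ε : ZMod n → Fin 2} {S : Sig n →* B}
  {K : Wt n → B} {E F : ZMod n → B} {s : Wt n → Sig n} {c : Wt n → ℤˣ}

theorem smul_mul_S_inj {a : Kq} (ha : a ≠ 0) (S : Sig n →* B) (g : Sig n) (x y : B) :
    a • (x * S g) = a • (y * S g) ↔ x = y := by
  rw [← sub_eq_zero, ← smul_sub, ← sub_mul, smul_eq_zero_iff_right ha, S_mul_eq_zero_iff,
    sub_eq_zero]

/-- The family `± K_μ s_μ`. -/
def twistK (S : Sig n →* B) (s : Wt n → Sig n) (c : Wt n → ℤˣ) (K : Wt n → B) (μ : Wt n) : B :=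
  usign (c μ) • (K μ * S (s μ))

/-- The twist is an involution; this produces the inverse of τ and lets the equivalences be used in
both directions. -/
theorem twistK_twistK (μ : Wt n) : twistK S s c (twistK S s c K) μ = K μ := by
  rw [twistK, twistK, smul_mul_assoc, smul_smul, usign_mul_self, one_smul, mul_assoc, ← map_mul,
    Sig.mul_self, map_one, mul_one]

theorem mul_S_mul_S (x : B) (g : Sig n) : x * S g * S g = x := by
  rw [mul_assoc, ← map_mul, Sig.mul_self, map_one, mul_one]

theorem S_comm (S : Sig n →* B) (g h : Sig n) : S g * S h = S h * S g := by
  rw [← map_mul, mul_comm, map_mul]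

theorem Equivariant.twist (h : Equivariant ε S K E F) (w w' : ZMod n → Sig n) :
    Equivariant ε S (twistK S s c K) (fun i => E i * S (w i)) (fun i => F i * S (w' i)) := by
  refine ⟨fun g μ => ?_, fun g i => ?_, fun g i => ?_⟩
  · rw [twistK, mul_smul_comm, smul_mul_assoc, ← mul_assoc, h.S_K, mul_assoc, mul_assoc, S_comm]
  · rw [← mul_assoc, h.S_E, smul_mul_assoc, mul_assoc, mul_assoc, S_comm]
  · rw [← mul_assoc, h.S_F, smul_mul_assoc, mul_assoc, mul_assoc, S_comm]

theorem weightHom_twistK_iff (hsc : IsWeightTwist ε s c) (hSK : ∀ g μ, S g * K μ = K μ * S g) :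
    WeightHom (twistK S s c K) ↔ WeightHom K := by
  have h0 : twistK S s c K 0 = K 0 := by
    rw [twistK, hsc.s_zero, hsc.c_zero, map_one, map_one, mul_one, one_smul]
  have h1 : ∀ μ ν, twistK S s c K (μ + ν) = twistK S s c K μ * twistK S s c K ν ↔
      K (μ + ν) = K μ * K ν := by
    intro μ ν
    have : twistK S s c K μ * twistK S s c K ν =
        usign (c (μ + ν)) • (K μ * K ν * S (s (μ + ν))) := by
      rw [twistK, twistK, smul_mul_smul_comm, ← map_mul, ← hsc.c_add, hsc.s_add, map_mul,
        mul_assoc, ← mul_assoc (S _), hSK]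
      simp only [mul_assoc]
    rw [this, twistK, smul_mul_S_inj (usign_ne_zero _)]
  exact ⟨fun h => ⟨h0 ▸ h.zero, fun μ ν => (h1 μ ν).1 (h.add μ ν)⟩,
    fun h => ⟨h0.trans h.zero, fun μ ν => (h1 μ ν).2 (h.add μ ν)⟩⟩

/-- The factor S(g) and the sign of K_μ affect both sides equally, so only χ_i(s_μ) survives; by
`IsWeightTwist.bq_eq` it is the ratio of the two weight scalars. -/
theorem twistK_conj_iff (hSK : ∀ g μ, S g * K μ = K μ * S g) {X : ZMod n → B}
    (hS : ∀ g i, S g * X i = chik ε g i • (X i * S g)) (μ : Wt n) (i : ZMod n) (g : Sig n)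
    (a : Kq) : twistK S s c K μ * (X i * S g) = a • (X i * S g * twistK S s c K μ) ↔
      K μ * X i = (a * chik ε (s μ) i) • (X i * K μ) := by
  have h1 : twistK S s c K μ * (X i * S g) =
      (usign (c μ) * chik ε (s μ) i) • (K μ * X i * S (s μ * g)) := by
    rw [twistK, smul_mul_assoc, twist_mul hS, smul_smul]
  have h2 : X i * S g * twistK S s c K μ = usign (c μ) • (X i * K μ * S (s μ * g)) := by
    rw [twistK, mul_smul_comm, mul_assoc, ← mul_assoc (S g), hSK, mul_comm (s μ), map_mul]
    simp only [mul_assoc]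
  have h3 : a • usign (c μ) • (X i * K μ * S (s μ * g)) = (usign (c μ) * chik ε (s μ) i) •
      (((a * chik ε (s μ) i) • (X i * K μ)) * S (s μ * g)) := by
    rw [smul_mul_assoc, smul_smul, smul_smul]
    congr 1
    linear_combination -(a * usign (c μ)) * chik_mul_self ε (s μ) i
  rw [h1, h2, h3, smul_mul_S_inj (mul_ne_zero (usign_ne_zero _) (chik_ne_zero _ _ _))]

/-- The extra factor `twK` in `twF` cancels the adjacency sign and leaves the pure super sign,
including for i = j. -/
theorem chi_twE_mul_chi_twF (hn : 4 ≤ n) (hε : ε 1 = 0) (i j : ZMod n) :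
    chi ε j (twE ε i) * chi ε i (twF ε j) = (-1) ^ (par ε i * par ε j) := by
  rw [twF, map_mul, ← mul_assoc]
  by_cases hij : i = j
  · subst hij
    rw [Int.units_mul_self, one_mul, chi_twK_self hn]
    rcases Nat.even_or_odd (par ε i) with h | h
    · rw [h.neg_one_pow, (h.mul_right _).neg_one_pow]
    · rw [h.neg_one_pow, (h.mul h).neg_one_pow]
  · rw [chi_twE_mul hn hε hij, chi_twK_eq hn ε (Ne.symm hij), adjSign_comm ε j i, mul_assoc,
      Int.units_mul_self, mul_one]

/-- For i = j the two copies of `twE` cancel in the product of group elements, leaving `twK`, which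
is the group part of the twisted K_i; the constants agree by `chi_twE_self`. -/
theorem E_F_twist_iff (hn : 4 ≤ n) (hε : ε 1 = 0) (hsc : IsWeightTwist ε s c)
    (h : Equivariant ε S K E F) (i j : ZMod n) :
    (E i * S (twE ε i) * (F j * S (twF ε j)) - (-1 : Kq) ^ (par ε i * par ε j) •
      (F j * S (twF ε j) * (E i * S (twE ε i))) =
      if i = j then ((-1) ^ (ε i : ℕ) / (q - q⁻¹)) •
        (twistK S s c K (root i) - twistK S s c K (-root i)) else 0) ↔
    E i * F j - F j * E i =
      if i = j then (1 / (q - q⁻¹)) • (K (root i) - K (-root i)) else 0 := by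
  have h1 : E i * S (twE ε i) * (F j * S (twF ε j)) - (-1 : Kq) ^ (par ε i * par ε j) •
      (F j * S (twF ε j) * (E i * S (twE ε i))) =
      chik ε (twE ε i) j • ((E i * F j - F j * E i) * S (twE ε i * twF ε j)) := by
    rw [twist_mul h.S_F, twist_mul h.S_E, mul_comm (twF ε j), smul_smul, ← usign_neg_one_pow,
      ← chi_twE_mul_chi_twF hn hε i j, chik_eq_usign, chik_eq_usign, map_mul usign,
      mul_assoc (usign _), usign_mul_self, mul_one, sub_mul, smul_sub]
  have h2 : (if i = j then ((-1) ^ (ε i : ℕ) / (q - q⁻¹)) •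
        (twistK S s c K (root i) - twistK S s c K (-root i)) else 0) =
      chik ε (twE ε i) j • ((if i = j then (1 / (q - q⁻¹)) • (K (root i) - K (-root i)) else 0)
        * S (twE ε i * twF ε j)) := by
    split_ifs with hij
    · subst hij
      rw [twistK, twistK, hsc.s_neg, hsc.c_neg, hsc.s_root, hsc.c_root, chik_eq_usign,
        chi_twE_self hn hε, map_mul, usign_neg_one_pow, twF, ← mul_assoc, Sig.mul_self, one_mul,
        ← smul_sub, ← sub_mul, smul_mul_assoc, smul_smul, smul_smul]
      congr 1
      ring
    · rw [zero_mul, smul_zero]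
  rw [h1, h2, smul_mul_S_inj (chik_ne_zero _ _ _)]

theorem superRep_twist_iff (hn : 4 ≤ n) (hε : ε 1 = 0) (hsc : IsWeightTwist ε s c)
    (h : Equivariant ε S K E F) :
    SuperRep ε (twistK S s c K) (fun i => E i * S (twE ε i)) (fun i => F i * S (twF ε i)) ↔
      GenRep ε K E F := by
  have h1 := weightHom_twistK_iff hsc h.S_K
  have h2 : ∀ μ i, _ ↔ _ := fun μ i =>
    twistK_conj_iff (c := c) h.S_K h.S_E μ i (twE ε i) (q ^ form ε μ (root i)) (s := s)
  have h3 : ∀ μ i, _ ↔ _ := fun μ i =>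
    twistK_conj_iff (c := c) h.S_K h.S_F μ i (twF ε i) (q ^ (-form ε μ (root i))) (s := s)
  have h4 : ∀ μ i, q ^ (-form ε μ (root i)) * chik ε (s μ) i = (bq ε μ (root i))⁻¹ := by
    intro μ i
    rw [hsc.bq_eq, mul_inv, zpow_neg, inv_eq_of_mul_eq_one_left (chik_mul_self ε (s μ) i)]
  simp only [← hsc.bq_eq, h4] at h2 h3
  have h5 := E_F_twist_iff hn hε hsc h
  have h6 := superSerre_twist_iff hn h.S_E (twistSign_twE hn hε)
  have h7 := superSerre_twist_iff hn h.S_F (twistSign_twF hn hε)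
  constructor
  · intro H
    exact ⟨h1.1 H.weight, fun μ i => (h2 μ i).1 (H.K_E μ i), fun μ i => (h3 μ i).1 (H.K_F μ i),
      fun i j => (h5 i j).1 (H.E_F i j), h6.1 H.serreE, h7.1 H.serreF⟩
  · intro H
    exact ⟨h1.2 H.weight, fun μ i => (h2 μ i).2 (H.K_E μ i), fun μ i => (h3 μ i).2 (H.K_F μ i),
      fun i j => (h5 i j).2 (H.E_F i j), h6.2 H.serreE, h7.2 H.serreF⟩

/-- Apply `superRep_twist_iff` to the twisted family, whose own twist is the original one. -/
theorem genRep_twist_iff (hn : 4 ≤ n) (hε : ε 1 = 0) (hsc : IsWeightTwist ε s c)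
    (h : Equivariant ε S K E F) :
    GenRep ε (twistK S s c K) (fun i => E i * S (twE ε i)) (fun i => F i * S (twF ε i)) ↔
      SuperRep ε K E F := by
  rw [← superRep_twist_iff hn hε hsc (h.twist (s := s) (c := c) (twE ε) (twF ε))]
  simp only [mul_S_mul_S]
  rw [show twistK S s c (twistK S s c K) = K from funext twistK_twistK]

end Twist

/-! ### The isomorphism of the extended algebras -/

theorem UGenSig.hom_ext {B : Type*} [Ring B] [Algebra Kq B] {ε : ZMod n → Fin 2}
    {φ ψ : UGenSig ε →ₐ[Kq] B} (hK : ∀ μ, φ (gK ε μ) = ψ (gK ε μ))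
    (hE : ∀ i, φ (gE ε i) = ψ (gE ε i)) (hF : ∀ i, φ (gF ε i) = ψ (gF ε i))
    (hS : ∀ g, φ (gS ε g) = ψ (gS ε g)) : φ = ψ := by
  have h1 : (φ.comp (skewIncl (UGen ε) (Sig n))).comp (mkG ε) =
      (ψ.comp (skewIncl (UGen ε) (Sig n))).comp (mkG ε) := by
    apply FreeAlgebra.hom_ext
    funext x
    cases x with
    | K μ => exact hK μ
    | E i => exact hE i
    | F i => exact hF i
  have h2 : ∀ x : UGen ε, φ (SkewMonoidAlgebra.single 1 x) = ψ (SkewMonoidAlgebra.single 1 x) := by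
    intro x
    obtain ⟨y, rfl⟩ := mkG_surjective ε x
    exact DFunLike.congr_fun h1 y
  apply AlgHom.ext
  intro x
  induction x using SkewMonoidAlgebra.induction_on with
  | zero => simp
  | single g a =>
    have : SkewMonoidAlgebra.single g a = SkewMonoidAlgebra.single 1 a * gS ε g := by
      rw [gS, SkewMonoidAlgebra.of_apply, SkewMonoidAlgebra.single_mul_single]; simp
    rw [this, map_mul, map_mul, h2, hS]
  | add x y hx hy => rw [map_add, map_add, hx, hy]

theorem USuperSig.hom_ext {B : Type*} [Ring B] [Algebra Kq B] {ε : ZMod n → Fin 2}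
    {φ ψ : USuperSig ε →ₐ[Kq] B} (hK : ∀ μ, φ (sK ε μ) = ψ (sK ε μ))
    (hE : ∀ i, φ (sE ε i) = ψ (sE ε i)) (hF : ∀ i, φ (sF ε i) = ψ (sF ε i))
    (hS : ∀ g, φ (sS ε g) = ψ (sS ε g)) : φ = ψ := by
  have h1 : (φ.comp (skewIncl (USuper ε) (Sig n))).comp (mkS ε) =
      (ψ.comp (skewIncl (USuper ε) (Sig n))).comp (mkS ε) := by
    apply FreeAlgebra.hom_ext
    funext x
    cases x with
    | K μ => exact hK μ
    | E i => exact hE i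
    | F i => exact hF i
  have h2 : ∀ x : USuper ε,
      φ (SkewMonoidAlgebra.single 1 x) = ψ (SkewMonoidAlgebra.single 1 x) := by
    intro x
    obtain ⟨y, rfl⟩ := mkS_surjective ε x
    exact DFunLike.congr_fun h1 y
  apply AlgHom.ext
  intro x
  induction x using SkewMonoidAlgebra.induction_on with
  | zero => simp
  | single g a =>
    have : SkewMonoidAlgebra.single g a = SkewMonoidAlgebra.single 1 a * sS ε g := by
      rw [sS, SkewMonoidAlgebra.of_apply, SkewMonoidAlgebra.single_mul_single]; simp
    rw [this, map_mul, map_mul, h2, hS]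
  | add x y hx hy => rw [map_add, map_add, hx, hy]

theorem exists_equiv (hn : 4 ≤ n) {ε : ZMod n → Fin 2} (hε : ε 1 = 0) {s : Wt n → Sig n}
    {c : Wt n → ℤˣ} (hsc : IsWeightTwist ε s c) :
    ∃ T : USuperSig ε ≃ₐ[Kq] UGenSig ε, (∀ μ, T (sK ε μ) = twistK (gS ε) s c (gK ε) μ) ∧
      (∀ i, T (sE ε i) = gE ε i * gS ε (twE ε i)) ∧
      (∀ i, T (sF ε i) = gF ε i * gS ε (twF ε i)) ∧ ∀ g, T (sS ε g) = gS ε g := by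
  obtain ⟨φ, φK, φE, φF, φS⟩ := exists_hom_USuperSig
    ((superRep_twist_iff hn hε hsc (equivariant_UGenSig ε)).2 (genRep_UGenSig ε))
    ((equivariant_UGenSig ε).twist _ _)
  obtain ⟨ψ, ψK, ψE, ψF, ψS⟩ := exists_hom_UGenSig
    ((genRep_twist_iff hn hε hsc (equivariant_USuperSig ε)).2 (superRep_USuperSig ε))
    ((equivariant_USuperSig ε).twist _ _)
  refine ⟨AlgEquiv.ofAlgHom φ ψ ?_ ?_, φK, φE, φF, φS⟩
  · apply UGenSig.hom_ext
    · intro μ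
      simp only [AlgHom.comp_apply, ψK, twistK, map_smul, map_mul, φK, φS]
      exact twistK_twistK μ
    · intro i; simp only [AlgHom.comp_apply, ψE, map_mul, φE, φS]; exact mul_S_mul_S _ _
    · intro i; simp only [AlgHom.comp_apply, ψF, map_mul, φF, φS]; exact mul_S_mul_S _ _
    · intro g; simp only [AlgHom.comp_apply, ψS, φS]; rfl
  · apply USuperSig.hom_ext
    · intro μ
      simp only [AlgHom.comp_apply, φK, twistK, map_smul, map_mul, ψK, ψS]
      exact twistK_twistK μ
    · intro i; simp only [AlgHom.comp_apply, φE, map_mul, ψE, ψS]; exact mul_S_mul_S _ _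
    · intro i; simp only [AlgHom.comp_apply, φF, map_mul, ψF, ψS]; exact mul_S_mul_S _ _
    · intro g; simp only [AlgHom.comp_apply, φS, ψS]; rfl

/-! ### Restriction to the subalgebras generated by the root and Λ₀ parts -/

theorem S_mem {B : Type*} [Ring B] [Algebra Kq B] {S : Sig n →* B} {A : Subalgebra Kq B}
    (h : ∀ j, S (sig j) ∈ A) (g : Sig n) : S g ∈ A := by
  have h1 : g ∈ A.toSubmonoid.comap S := by
    rw [← Finset.univ_prod_mulSingle g]
    refine Submonoid.prod_mem _ fun j _ => ?_
    rcases Int.units_eq_one_or (g j) with hg | hg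
    · rw [hg, Pi.mulSingle_one]; exact Submonoid.one_mem _
    · rw [hg]; exact h j
  exact h1

theorem map_subX {ε : ZMod n → Fin 2} {s : Wt n → Sig n} {c : Wt n → ℤˣ}
    (T : USuperSig ε ≃ₐ[Kq] UGenSig ε) (hK : ∀ μ, T (sK ε μ) = twistK (gS ε) s c (gK ε) μ)
    (hE : ∀ i, T (sE ε i) = gE ε i * gS ε (twE ε i))
    (hF : ∀ i, T (sF ε i) = gF ε i * gS ε (twF ε i)) (hS : ∀ g, T (sS ε g) = gS ε g) :
    (subX ε).map (T : USuperSig ε →ₐ[Kq] UGenSig ε) = subY ε := by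
  have htw : ∀ (A : Subalgebra Kq (UGenSig ε)) (K : Wt n → UGenSig ε) (μ : Wt n),
      (∀ j, gS ε (sig j) ∈ A) → K μ ∈ A → twistK (gS ε) s c K μ ∈ A := fun A K μ h1 h2 =>
    A.smul_mem (A.mul_mem h2 (S_mem h1 _)) _
  rw [subX, AlgHom.map_adjoin, subY]
  apply le_antisymm
  · have hmem : ∀ {x}, x ∈ genSetG ε → x ∈ Algebra.adjoin Kq (genSetG ε) :=
      fun h => Algebra.subset_adjoin h
    have h1 : ∀ j, gS ε (sig j) ∈ Algebra.adjoin Kq (genSetG ε) := fun j =>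
      hmem (Or.inr (Or.inr (Or.inr (Or.inr (Or.inr (Or.inr ⟨j, rfl⟩))))))
    refine Algebra.adjoin_le ?_
    rintro _ ⟨x, hx, rfl⟩
    change T x ∈ Algebra.adjoin Kq (genSetG ε)
    rcases hx with ⟨i, rfl⟩ | ⟨i, rfl⟩ | ⟨i, rfl⟩ | ⟨i, rfl⟩ | rfl | rfl | ⟨j, rfl⟩
    · rw [hE]; exact mul_mem (hmem (Or.inl ⟨i, rfl⟩)) (S_mem h1 _)
    · rw [hF]; exact mul_mem (hmem (Or.inr (Or.inl ⟨i, rfl⟩))) (S_mem h1 _)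
    · rw [hK]; exact htw _ _ _ h1 (hmem (Or.inr (Or.inr (Or.inl ⟨i, rfl⟩))))
    · rw [hK]; exact htw _ _ _ h1 (hmem (Or.inr (Or.inr (Or.inr (Or.inl ⟨i, rfl⟩)))))
    · rw [hK]; exact htw _ _ _ h1 (hmem (Or.inr (Or.inr (Or.inr (Or.inr (Or.inl rfl))))))
    · rw [hK]
      exact htw _ _ _ h1 (hmem (Or.inr (Or.inr (Or.inr (Or.inr (Or.inr (Or.inl rfl)))))))
    · rw [hS]; exact h1 j
  · have hmem : ∀ {x}, x ∈ genSetS ε → T x ∈ Algebra.adjoin Kq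
        ((T : USuperSig ε →ₐ[Kq] UGenSig ε) '' genSetS ε) :=
      fun h => Algebra.subset_adjoin ⟨_, h, rfl⟩
    have h1 : ∀ j, gS ε (sig j) ∈ Algebra.adjoin Kq
        ((T : USuperSig ε →ₐ[Kq] UGenSig ε) '' genSetS ε) := fun j => by
      rw [← hS]; exact hmem (Or.inr (Or.inr (Or.inr (Or.inr (Or.inr (Or.inr ⟨j, rfl⟩))))))
    have h2 : ∀ μ, sK ε μ ∈ genSetS ε → gK ε μ ∈ Algebra.adjoin Kq
        ((T : USuperSig ε →ₐ[Kq] UGenSig ε) '' genSetS ε) := fun μ h => by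
      -- Twisting again writes k_μ as a sign times the image of K_μ times a group element, so it
      -- lies in the image.
      rw [← twistK_twistK (S := gS ε) (K := gK ε) (s := s) (c := c) μ]
      exact htw _ _ _ h1 (hK μ ▸ hmem h)
    refine Algebra.adjoin_le ?_
    rintro x (⟨i, rfl⟩ | ⟨i, rfl⟩ | ⟨i, rfl⟩ | ⟨i, rfl⟩ | rfl | rfl | ⟨j, rfl⟩)
    · rw [← mul_S_mul_S (S := gS ε) (gE ε i) (twE ε i), ← hE]
      exact mul_mem (hmem (Or.inl ⟨i, rfl⟩)) (S_mem h1 _)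
    · rw [← mul_S_mul_S (S := gS ε) (gF ε i) (twF ε i), ← hF]
      exact mul_mem (hmem (Or.inr (Or.inl ⟨i, rfl⟩))) (S_mem h1 _)
    · exact h2 _ (Or.inr (Or.inr (Or.inl ⟨i, rfl⟩)))
    · exact h2 _ (Or.inr (Or.inr (Or.inr (Or.inl ⟨i, rfl⟩))))
    · exact h2 _ (Or.inr (Or.inr (Or.inr (Or.inr (Or.inl rfl)))))
    · exact h2 _ (Or.inr (Or.inr (Or.inr (Or.inr (Or.inr (Or.inl rfl))))))
    · exact h1 j

/-- The isomorphism `τ` with its values on the generators. -/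
theorem exists_tau (hn : 4 ≤ n) {ε : ZMod n → Fin 2} (hε : ε 1 = 0) :
    ∃ τ : subX ε ≃ₐ[Kq] subY ε,
      (∀ i, (τ (xE ε i) : UGenSig ε) = tauE ε i) ∧ (∀ i, (τ (xF ε i) : UGenSig ε) = tauF ε i) ∧
      (∀ i, (τ (xK ε i) : UGenSig ε) = tauK ε i) ∧
      (∀ j, (τ (xS ε j) : UGenSig ε) = gS ε (sig j)) ∧
      (τ (xLam ε) : UGenSig ε) = gK ε (Lam n) := by
  obtain ⟨s, c, hsc⟩ := exists_weight_twist hn ε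
  obtain ⟨T, hK, hE, hF, hS⟩ := exists_equiv hn hε hsc
  refine ⟨(T.subalgebraMap (subX ε)).trans
    (Subalgebra.equivOfEq _ _ (map_subX T hK hE hF hS)), fun i => ?_, fun i => ?_, fun i => ?_,
    fun j => ?_, ?_⟩
  · exact (hE i).trans (tauE_eq ε i).symm
  · exact (hF i).trans (tauF_eq ε i).symm
  · refine (hK (root i)).trans ?_
    rw [tauK_eq, twistK, hsc.s_root, hsc.c_root]; rfl
  · exact hS (sig j)
  · refine (hK (Lam n)).trans ?_
    rw [twistK, hsc.s_Lam, hsc.c_Lam, map_one, map_one, one_smul, mul_one]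

/-! ### Failure of compatibility with the comultiplications -/

/-- The counit in disguise: e_i and f_i go to 0, and `bq ε μ 0` is the constant 1. It serves to show
that 𝒰[σ] is nonzero. -/
theorem genRep_counit (ε : ZMod n → Fin 2) :
    GenRep (B := Kq) ε (fun μ => bq ε μ 0) (fun _ => 0) (fun _ => 0) := by
  have h0 : ∀ μ : Wt n, bq ε μ 0 = 1 := fun μ => by simp [bq]
  simp only [h0]
  refine ⟨⟨rfl, fun _ _ => (mul_one _).symm⟩, ?_, ?_, ?_, ?_, ?_⟩
  · intro μ i; simp
  · intro μ i; simp
  · intro i j; simp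
  all_goals
    exact ⟨fun _ _ => by simp, fun _ _ _ _ => by simp [qbr], fun _ _ _ _ => by simp [cubic],
      fun _ _ => by simp [quartic]⟩

instance UGenSig.nontrivial (ε : ZMod n → Fin 2) : Nontrivial (UGenSig ε) := by
  obtain ⟨φ, -⟩ := exists_hom_UGenSig (S := (1 : Sig n →* Kq)) (genRep_counit ε)
    ⟨fun _ _ => by simp, fun _ _ => by simp, fun _ _ => by simp⟩
  exact φ.toRingHom.domain_nontrivial

/-- Starting from ε_1 = 0 and meeting a one somewhere, ε must step from 0 to 1. The index after the
step opens a block, so m = 1 and the sign is -1 whatever ε does next. -/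
theorem exists_twC_eq_neg_one {ε : ZMod n → Fin 2} (hN : numOne ε ≠ 0) (hε : ε 1 = 0) :
    ∃ i, twC ε i = -1 := by
  obtain ⟨i, hi, hi'⟩ : ∃ i, ε i = 0 ∧ ε (i + 1) = 1 := by
    by_contra! hcon
    have h : ∀ a : ℕ, ε ((a + 1 : ℕ) : ZMod n) = 0 := by
      intro a
      induction a with
      | zero => simpa using hε
      | succ a ih =>
        rcases eq_zero_or_one (ε ((a + 1 + 1 : ℕ) : ZMod n)) with h | h
        · exact h
        · rw [Nat.cast_succ] at h
          exact absurd h (hcon _ ih)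
    apply hN
    rw [numOne, Finset.card_eq_zero, Finset.filter_eq_empty_iff]
    intro i _
    obtain ⟨m, hm⟩ := Nat.exists_eq_add_of_le' (one_le_pos i)
    have := h m
    rw [← hm, natCast_pos] at this
    rw [this]; decide
  have h0 : i ≠ 0 := by rintro rfl; rw [zero_add, hε] at hi'; exact absurd hi' (by decide)
  refine ⟨i + 1, ?_⟩
  rw [twC, hi', blockPos_succ_of_ne h0 (by rw [hi, hi']; decide)]
  simp

/-- For such an i, τ(K_i) = -u with u group-like, so compatibility would give u ⊗ u = -(u ⊗ u). In
characteristic zero this forces u ⊗ u = 0, impossible since u is invertible and the tensor square is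
nonzero. -/
theorem not_preservesComul {ε : ZMod n → Fin 2} (hN : numOne ε ≠ 0) (hε : ε 1 = 0)
    {τ : subX ε ≃ₐ[Kq] subY ε} (hτ : ∀ i, (τ (xK ε i) : UGenSig ε) = tauK ε i)
    {ΔS : USuperSig ε →ₐ[Kq] USuperSig ε ⊗[Kq] USuperSig ε}
    {ΔG : UGenSig ε →ₐ[Kq] UGenSig ε ⊗[Kq] UGenSig ε} (hΔS : IsComulS ε ΔS)
    (hΔG : IsComulG ε ΔG) (hgS : ∀ g, ΔG (gS ε g) = gS ε g ⊗ₜ gS ε g) :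
    ¬ PreservesComul ε τ ΔS ΔG := by
  intro h
  obtain ⟨i, hi⟩ := exists_twC_eq_neg_one hN hε
  have h1 := h (xK ε i) (xK ε i ⊗ₜ xK ε i) (by
    rw [Algebra.TensorProduct.map_tmul]; exact (hΔS.map_K (root i)).symm)
  rw [Algebra.TensorProduct.map_tmul] at h1
  change (τ (xK ε i) : UGenSig ε) ⊗ₜ (τ (xK ε i) : UGenSig ε) = _ at h1
  have hw := (genRep_UGenSig ε).weight
  generalize hu : gK ε (root i) * gS ε (twK ε i) = u at *
  have hΔ : ΔG u = u ⊗ₜ u := by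
    rw [← hu, map_mul, hΔG.map_K, hgS, Algebra.TensorProduct.tmul_mul_tmul]
  have huv : u * (gS ε (twK ε i) * gK ε (-root i)) = 1 := by
    rw [← hu, ← mul_assoc, mul_S_mul_S, hw.mul_neg]
  rw [hτ, tauK_eq, hi, hu] at h1
  simp only [Units.val_neg, Units.val_one, Int.cast_neg, Int.cast_one, neg_smul, one_smul,
    map_neg, hΔ, TensorProduct.neg_tmul, TensorProduct.tmul_neg, neg_neg] at h1
  have h2 : (2 : Kq) • (u ⊗ₜ[Kq] u) = 0 := by
    rw [two_smul]; nth_rewrite 1 [h1]; exact neg_add_cancel _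
  have h3 : u ⊗ₜ[Kq] u = 0 := (smul_eq_zero_iff_right two_ne_zero).1 h2
  have h4 : (1 : UGenSig ε ⊗[Kq] UGenSig ε) = 0 := by
    rw [Algebra.TensorProduct.one_def, ← huv, ← Algebra.TensorProduct.tmul_mul_tmul, h3, zero_mul]
  exact one_ne_zero h4

/-! ### Additivity of the relations for `q`-commuting families -/

section Additive

variable {C : Type*} [Ring C] [Algebra Kq C]

theorem swap_assoc {x y : C} {t : Kq} (h : x * y = t • (y * x)) (z : C) :
    x * (y * z) = t • (y * (x * z)) := by
  rw [← mul_assoc, h, smul_mul_assoc, mul_assoc]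

/-- Once the letters of the second family are moved to the left, the coefficients of all mixed words
vanish identically in v. -/
theorem cubic_add {v : Kq} (hv : v ≠ 0) {a b c d : C} (hab : a * b = v ^ 2 • (b * a))
    (had : a * d = v⁻¹ • (d * a)) (hcb : c * b = v⁻¹ • (b * c)) :
    cubic (v + v⁻¹) (a + b) (c + d) = cubic (v + v⁻¹) a c + cubic (v + v⁻¹) b d := by
  simp only [cubic, pow_two, mul_add, add_mul, mul_assoc, hab, had, hcb, swap_assoc hab,
    swap_assoc had, swap_assoc hcb, mul_smul_comm, smul_mul_assoc, smul_add, smul_smul]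
  match_scalars <;> field_simp <;> ring

/-- The same cancellation of mixed words; it also uses that the middle letters square to zero and
anticommute across the families, and that the outer letters commute. -/
theorem quartic_add {v : Kq} (hv : v ≠ 0) {a₁ a₂ a₃ b₁ b₂ b₃ : C}
    (h₁₂ : a₁ * b₂ = v⁻¹ • (b₂ * a₁)) (h₂₁ : a₂ * b₁ = v⁻¹ • (b₁ * a₂))
    (h₂₃ : a₂ * b₃ = (-v) • (b₃ * a₂)) (h₃₂ : a₃ * b₂ = (-v) • (b₂ * a₃))
    (h₁₃ : a₁ * b₃ = (1 : Kq) • (b₃ * a₁)) (h₃₁ : a₃ * b₁ = (1 : Kq) • (b₁ * a₃))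
    (h₂₂ : a₂ * b₂ = (-1 : Kq) • (b₂ * a₂)) (ha : a₂ * a₂ = 0) (hb : b₂ * b₂ = 0)
    (ca : a₁ * a₃ = (1 : Kq) • (a₃ * a₁)) (cb : b₁ * b₃ = (1 : Kq) • (b₃ * b₁)) :
    quartic (v + v⁻¹) (a₁ + b₁) (a₂ + b₂) (a₃ + b₃) =
      quartic (v + v⁻¹) a₁ a₂ a₃ + quartic (v + v⁻¹) b₁ b₂ b₃ := by
  have hb' : ∀ t, b₂ * (b₂ * t) = 0 := fun t => by rw [← mul_assoc, hb, zero_mul]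
  simp only [quartic, mul_add, add_mul, mul_assoc, h₁₂, h₂₁, h₂₃, h₃₂, h₁₃, h₃₁, h₂₂, ha, ca,
    cb, hb', swap_assoc h₁₂, swap_assoc h₂₁, swap_assoc h₂₃, swap_assoc h₃₂, swap_assoc h₁₃,
    swap_assoc h₃₁, swap_assoc h₂₂, swap_assoc cb, mul_smul_comm, smul_mul_assoc,
    smul_add, smul_smul, mul_zero, smul_zero, add_zero, zero_add]
  match_scalars <;> field_simp <;> ring

theorem bq_root_self (hn : 4 ≤ n) (ε : ZMod n → Fin 2) (i : ZMod n) :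
    bq ε (root i) (root i) = qi ε i * qi ε (i + 1) := by
  rw [bq_root]
  have := self_ne_succ hn i
  simp [root, this, this.symm]

theorem bq_root_succ (hn : 4 ≤ n) (ε : ZMod n → Fin 2) (i : ZMod n) :
    bq ε (root i) (root (i + 1)) = (qi ε (i + 1))⁻¹ := by
  rw [bq_root]
  have h1 := self_ne_succ hn i
  have h2 := self_ne_succ hn (i + 1)
  have h3 : i + 1 + 1 ≠ i := fun h => two_ne_zero' hn (by linear_combination h)
  simp [root, h1.symm, h2.symm, h3]

theorem bq_root_of_not_adj {ε : ZMod n → Fin 2} {i j : ZMod n} (hij : i ≠ j) (h1 : i - j ≠ 1)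
    (h2 : i - j ≠ -1) : bq ε (root i) (root j) = 1 := by
  rw [bq_root]
  have e1 : j ≠ i + 1 := fun h => h2 (by rw [h]; ring)
  have e2 : j + 1 ≠ i := fun h => h1 (by rw [← h]; ring)
  simp [root, hij.symm, e1, e2]

theorem qi_succ_of_isOdd (hn : 4 ≤ n) {ε : ZMod n → Fin 2} {i : ZMod n} (hi : IsOdd ε i) :
    qi ε (i + 1) = -(qi ε i)⁻¹ := by
  rw [isOdd_iff hn] at hi
  unfold qi
  rcases eq_zero_or_one (ε i) with h | h <;> rcases eq_zero_or_one (ε (i + 1)) with h' | h' <;>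
    simp_all [inv_neg]

theorem bq_of_isEven (hn : 4 ≤ n) {ε : ZMod n → Fin 2} {i j : ZMod n} (hi : IsEven ε i)
    (h : i - j = 1 ∨ i - j = -1) : bq ε (root i) (root j) = (qi ε i)⁻¹ := by
  rcases h with h | h
  · obtain rfl : i = j + 1 := by rw [← h]; ring
    rw [bq_comm, bq_root_succ hn]
  · obtain rfl : j = i + 1 := by linear_combination -h
    rw [bq_root_succ hn, qi, qi, (isEven_iff hn ε i).1 hi]

/-- The 𝐪-values on pairs of roots are exactly the exchange scalars required by `cubic_add` and
`quartic_add` with v = q_i; in particular 𝐪(α_i, α_i) is q_i² for even i and -1 for odd i. -/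
theorem GenSerre.add (hn : 4 ≤ n) {ε : ZMod n → Fin 2} {P Q : ZMod n → C} (hP : GenSerre ε P)
    (hQ : GenSerre ε Q) (h : ∀ i j, P i * Q j = bq ε (root i) (root j) • (Q j * P i)) :
    GenSerre ε (fun i => P i + Q i) := by
  have hself : ∀ i, IsOdd ε i → bq ε (root i) (root i) = -1 := by
    intro i hi
    rw [bq_root_self hn, qi_succ_of_isOdd hn hi]
    field_simp [qi_ne_zero]
  refine ⟨fun i hi => ?_, fun i j h1 h2 => ?_, fun i j hi hij => ?_, fun i hi => ?_⟩
  · have h1 := hP.sq i hi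
    have h2 := hQ.sq i hi
    have h3 := h i i
    rw [hself i hi, neg_one_smul] at h3
    rw [pow_two] at h1 h2 ⊢
    rw [add_mul, mul_add, mul_add, h1, h2, h3]; simp
  · by_cases hij : i = j
    · subst hij; simp [qbr]
    · have h3 := hP.comm i j h1 h2
      have h4 := hQ.comm i j h1 h2
      have h5 := h i j
      have h6 := h j i
      rw [bq_root_of_not_adj hij h1 h2, one_smul] at h5
      rw [bq_comm, bq_root_of_not_adj hij h1 h2, one_smul] at h6
      rw [qbr, one_smul, sub_eq_zero] at *
      rw [add_mul, mul_add, mul_add, add_mul, mul_add, mul_add, h3, h4, h5, h6]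
      abel
  · have h1 := hP.cubic i j hi hij
    have h2 := hQ.cubic i j hi hij
    rw [two_qi] at h1 h2 ⊢
    rw [cubic_add (qi_ne_zero ε i), h1, h2, add_zero]
    · rw [h, bq_root_self hn, pow_two]
      congr 2
      rw [qi, qi, (isEven_iff hn ε i).1 hi]
    · rw [h, bq_of_isEven hn hi hij]
    · rw [h, bq_comm, bq_of_isEven hn hi hij]
  · have h1 := hP.quartic i hi
    have h2 := hQ.quartic i hi
    have n1 : i - 1 - (i + 1) ≠ 1 := fun h => three_ne_zero' hn (by linear_combination -h)
    have n2 : i - 1 - (i + 1) ≠ -1 := fun h => one_ne_zero' hn (by linear_combination -h)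
    have n3 : i - 1 ≠ i + 1 := fun h => two_ne_zero' hn (by linear_combination -h)
    have b1 : bq ε (root (i - 1)) (root i) = (qi ε i)⁻¹ := by
      simpa using bq_root_succ hn ε (i - 1)
    have b2 : bq ε (root i) (root (i + 1)) = -qi ε i := by
      rw [bq_root_succ hn, qi_succ_of_isOdd hn hi, inv_neg, inv_inv]
    have b3 := bq_root_of_not_adj (ε := ε) n3 n1 n2
    have c1 := hP.comm _ _ n1 n2
    have c2 := hQ.comm _ _ n1 n2
    rw [qbr, sub_eq_zero] at c1 c2
    rw [two_qi] at h1 h2 ⊢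
    rw [quartic_add (qi_ne_zero ε i), h1, h2, add_zero]
    · rw [h, b1]
    · rw [h, bq_comm, b1]
    · rw [h, b2]
    · rw [h, bq_comm, b2]
    · rw [h, b3]
    · rw [h, bq_comm, b3]
    · rw [h, hself i hi]
    · rw [← pow_two, hP.sq i hi]
    · rw [← pow_two, hQ.sq i hi]
    · exact c1
    · exact c2

theorem GenSerre.map {D : Type*} [Ring D] [Algebra Kq D] {ε : ZMod n → Fin 2} {X : ZMod n → C}
    (h : GenSerre ε X) (φ : C →ₐ[Kq] D) : GenSerre ε (fun i => φ (X i)) := by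
  refine ⟨fun i hi => ?_, fun i j h1 h2 => ?_, fun i j hi hij => ?_, fun i hi => ?_⟩
  · rw [← map_pow, h.sq i hi, map_zero]
  · rw [← map_qbr, h.comm i j h1 h2, map_zero]
  · rw [← map_cubic, h.cubic i j hi hij, map_zero]
  · rw [← map_quartic, h.quartic i hi, map_zero]

/-- Every Serre relation is homogeneous in each generator, so the commuting elements a_i contribute
one common factor to all its monomials. -/
theorem GenSerre.tmul_left {D : Type*} [Ring D] [Algebra Kq D] {ε : ZMod n → Fin 2}
    {X : ZMod n → C} (h : GenSerre ε X) {a : ZMod n → D} (ha : ∀ i j, a i * a j = a j * a i) :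
    GenSerre ε (fun i => a i ⊗ₜ[Kq] X i) := by
  have ha' : ∀ i j t, a i * (a j * t) = a j * (a i * t) := fun i j t => by
    rw [← mul_assoc, ha, mul_assoc]
  refine ⟨fun i hi => ?_, fun i j h1 h2 => ?_, fun i j hi hij => ?_, fun i hi => ?_⟩
  · rw [pow_two, Algebra.TensorProduct.tmul_mul_tmul, ← pow_two (X i), h.sq i hi,
      TensorProduct.tmul_zero]
  · have : qbr 1 (a i ⊗ₜ[Kq] X i) (a j ⊗ₜ[Kq] X j) = (a i * a j) ⊗ₜ qbr 1 (X i) (X j) := by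
      rw [qbr, qbr, TensorProduct.tmul_sub, Algebra.TensorProduct.tmul_mul_tmul,
        Algebra.TensorProduct.tmul_mul_tmul, ha j i, TensorProduct.tmul_smul]
    rw [this, h.comm i j h1 h2, TensorProduct.tmul_zero]
  · have : ∀ c, QSuper.cubic c (a i ⊗ₜ[Kq] X i) (a j ⊗ₜ[Kq] X j) =
        (a i * a i * a j) ⊗ₜ QSuper.cubic c (X i) (X j) := by
      intro c
      have e1 : a i * a j * a i = a i * a i * a j := by rw [mul_assoc, ha j i, mul_assoc]
      have e2 : a j * (a i * a i) = a i * a i * a j := by rw [ha' j i, ha j i, mul_assoc]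
      simp only [QSuper.cubic, pow_two, TensorProduct.tmul_add, TensorProduct.tmul_sub,
        Algebra.TensorProduct.tmul_mul_tmul, TensorProduct.tmul_smul, e1, e2]
    rw [this, h.cubic i j hi hij, TensorProduct.tmul_zero]
  · have : ∀ (c : Kq) (j k l : ZMod n),
        QSuper.quartic c (a j ⊗ₜ[Kq] X j) (a k ⊗ₜ[Kq] X k) (a l ⊗ₜ[Kq] X l) =
        (a k * a j * a k * a l) ⊗ₜ QSuper.quartic c (X j) (X k) (X l) := by
      intro c j k l
      have e1 : a k * a l * a k * a j = a k * a j * a k * a l := by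
        simp only [mul_assoc, ha' l k, ha' j k, ha l j]
      have e2 : a l * a k * a j * a k = a k * a j * a k * a l := by
        simp only [mul_assoc, ha l]
      have e3 : a j * a k * a l * a k = a k * a j * a k * a l := by
        simp only [mul_assoc, ha' j k, ha l k]
      have e4 : a k * a j * a l * a k = a k * a j * a k * a l := by
        simp only [mul_assoc, ha l k]
      simp only [QSuper.quartic, TensorProduct.tmul_add, TensorProduct.tmul_sub,
        Algebra.TensorProduct.tmul_mul_tmul, TensorProduct.tmul_smul, e1, e2, e3, e4]
    rw [this, h.quartic i hi, TensorProduct.tmul_zero]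

theorem GenSerre.tmul_right {D : Type*} [Ring D] [Algebra Kq D] {ε : ZMod n → Fin 2}
    {X : ZMod n → C} (h : GenSerre ε X) {a : ZMod n → D} (ha : ∀ i j, a i * a j = a j * a i) :
    GenSerre ε (fun i => X i ⊗ₜ[Kq] a i) :=
  (h.tmul_left ha).map (Algebra.TensorProduct.comm Kq D C : D ⊗[Kq] C →ₐ[Kq] C ⊗[Kq] D)

/-- The condition on α and β says that the two summands exchange with the scalar 𝐪(α_i, α_j), as
`GenSerre.add` demands. -/
theorem GenSerre.comul (hn : 4 ≤ n) {ε : ZMod n → Fin 2} {X a b : ZMod n → C}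
    (h : GenSerre ε X) {α β : ZMod n → ZMod n → Kq} (ha : ∀ i j, a i * a j = a j * a i)
    (hb : ∀ i j, b i * b j = b j * b i) (haX : ∀ i j, a i * X j = α i j • (X j * a i))
    (hbX : ∀ i j, b i * X j = β i j • (X j * b i))
    (hαβ : ∀ i j, α i j = bq ε (root i) (root j) * β j i) :
    GenSerre ε (fun i => a i ⊗ₜ[Kq] X i + X i ⊗ₜ[Kq] b i) := by
  refine (h.tmul_left ha).add hn (h.tmul_right hb) fun i j => ?_
  rw [Algebra.TensorProduct.tmul_mul_tmul, Algebra.TensorProduct.tmul_mul_tmul, haX, hbX, hαβ,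
    ← TensorProduct.smul_tmul', TensorProduct.tmul_smul, smul_smul]

theorem GenSerre.comul' (hn : 4 ≤ n) {ε : ZMod n → Fin 2} {X a b : ZMod n → C}
    (h : GenSerre ε X) {α β : ZMod n → ZMod n → Kq} (ha : ∀ i j, a i * a j = a j * a i)
    (hb : ∀ i j, b i * b j = b j * b i) (haX : ∀ i j, a i * X j = α i j • (X j * a i))
    (hbX : ∀ i j, b i * X j = β i j • (X j * b i))
    (hαβ : ∀ i j, α i j = bq ε (root i) (root j) * β j i) :
    GenSerre ε (fun i => X i ⊗ₜ[Kq] a i + b i ⊗ₜ[Kq] X i) := by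
  have := (h.comul hn ha hb haX hbX hαβ).map
    (Algebra.TensorProduct.comm Kq C C : C ⊗[Kq] C →ₐ[Kq] C ⊗[Kq] C)
  simpa using this

end Additive

/-! ### The comultiplications -/

section Comul

variable {B : Type*} [Ring B] [Algebra Kq B] {ε : ZMod n → Fin 2} {S : Sig n →* B}
  {K : Wt n → B} {E F : ZMod n → B}

/-- The diagonal family `K_μ ⊗ K_μ`. -/
def comulK (K : Wt n → B) (μ : Wt n) : B ⊗[Kq] B := K μ ⊗ₜ K μ

/-- The diagonal homomorphism `g ↦ g ⊗ g`. -/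
def comulS (S : Sig n →* B) : Sig n →* B ⊗[Kq] B where
  toFun g := S g ⊗ₜ S g
  map_one' := by rw [map_one]; rfl
  map_mul' g h := by rw [map_mul, Algebra.TensorProduct.tmul_mul_tmul]

/-- The family `π_i ⊗ E_i + E_i ⊗ K_i⁻¹`. -/
def comulE (S : Sig n →* B) (K : Wt n → B) (E : ZMod n → B) (π : ZMod n → Sig n) (i : ZMod n) :
    B ⊗[Kq] B :=
  S (π i) ⊗ₜ E i + E i ⊗ₜ K (-root i)

/-- The family `F_i ⊗ 1 + K_i π_i ⊗ F_i`. -/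
def comulF (S : Sig n →* B) (K : Wt n → B) (F : ZMod n → B) (π : ZMod n → Sig n) (i : ZMod n) :
    B ⊗[Kq] B :=
  F i ⊗ₜ 1 + (K (root i) * S (π i)) ⊗ₜ F i

theorem WeightHom.comul (h : WeightHom K) : WeightHom (comulK K) := by
  refine ⟨?_, fun μ ν => ?_⟩
  · rw [comulK, h.zero]; rfl
  · rw [comulK, h.add, comulK, comulK, Algebra.TensorProduct.tmul_mul_tmul]

theorem Equivariant.comul (h : Equivariant ε S K E F) (π : ZMod n → Sig n) :
    Equivariant ε (comulS S) (comulK K) (comulE S K E π) (comulF S K F π) := by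
  refine ⟨fun g μ => ?_, fun g i => ?_, fun g i => ?_⟩
  · change S g ⊗ₜ S g * K μ ⊗ₜ K μ = K μ ⊗ₜ K μ * S g ⊗ₜ[Kq] S g
    simp only [Algebra.TensorProduct.tmul_mul_tmul, h.S_K]
  · change S g ⊗ₜ S g * (_ + _) = chik ε g i • ((_ + _) * S g ⊗ₜ[Kq] S g)
    simp only [mul_add, add_mul, Algebra.TensorProduct.tmul_mul_tmul, h.S_K, h.S_E,
      S_comm S g (π i), smul_add, ← TensorProduct.smul_tmul', TensorProduct.tmul_smul]
  · change S g ⊗ₜ S g * (_ + _) = chik ε g i • ((_ + _) * S g ⊗ₜ[Kq] S g)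
    have : S g * (K (root i) * S (π i)) = K (root i) * S (π i) * S g := by
      rw [← mul_assoc, h.S_K, mul_assoc, mul_assoc, S_comm]
    simp only [mul_add, add_mul, Algebra.TensorProduct.tmul_mul_tmul, this, h.S_F, mul_one,
      one_mul, smul_add, ← TensorProduct.smul_tmul', TensorProduct.tmul_smul]

theorem comulK_mul_comulE (hK : WeightHom K) (hS : Equivariant ε S K E F) (π : ZMod n → Sig n)
    {a : Kq} {μ : Wt n} {i : ZMod n} (h : K μ * E i = a • (E i * K μ)) :
    comulK K μ * comulE S K E π i = a • (comulE S K E π i * comulK K μ) := by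
  simp only [comulK, comulE, mul_add, add_mul, Algebra.TensorProduct.tmul_mul_tmul, h,
    hS.S_K, hK.comm μ, smul_add, ← TensorProduct.smul_tmul', TensorProduct.tmul_smul]

theorem comulK_mul_comulF (hK : WeightHom K) (hS : Equivariant ε S K E F) (π : ZMod n → Sig n)
    {a : Kq} {μ : Wt n} {i : ZMod n} (h : K μ * F i = a • (F i * K μ)) :
    comulK K μ * comulF S K F π i = a • (comulF S K F π i * comulK K μ) := by
  have : K μ * (K (root i) * S (π i)) = K (root i) * S (π i) * K μ := by
    rw [← mul_assoc, hK.comm, mul_assoc, mul_assoc, hS.S_K]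
  simp only [comulK, comulF, mul_add, add_mul, Algebra.TensorProduct.tmul_mul_tmul, h, this,
    mul_one, one_mul, smul_add, ← TensorProduct.smul_tmul', TensorProduct.tmul_smul]

/-- Serves both coproducts, with θ the super sign or 1. The cross terms cancel, leaving the bracket
of E_i and F_j in each tensor factor; for i = j, K ⊗ (K - K⁻¹) + (K - K⁻¹) ⊗ K⁻¹ telescopes. -/
theorem comul_E_F (hS : Equivariant ε S K E F) {π : ZMod n → Sig n}
    {θ κ : ZMod n → ZMod n → Kq} {d : ZMod n → Kq}
    (hπ : ∀ i j, chik ε (π i) j = θ i j) (hθ : ∀ i j, θ i j = θ j i)  (hκs : ∀ i j, κ i j = κ j i)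
    (hKE : ∀ i j, K (root i) * E j = κ i j • (E j * K (root i)))
    (hKF : ∀ i j, K (-root i) * F j = κ i j • (F j * K (-root i)))
    (hEF : ∀ i j, E i * F j - θ i j • (F j * E i) =
      if i = j then d i • (K (root i) - K (-root i)) else 0) (i j : ZMod n) :
    comulE S K E π i * comulF S K F π j - θ i j • (comulF S K F π j * comulE S K E π i) =
      if i = j then d i • (comulK K (root i) - comulK K (-root i)) else 0 := by
  have hθθ : θ i j * θ i j = 1 := by rw [← hπ, chik_mul_self]
  have e1 : S (π i) * F j = θ i j • (F j * S (π i)) := by rw [hS.S_F, hπ]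
  have e2 : K (root j) * S (π j) * E i = (κ i j * θ i j) • (E i * (K (root j) * S (π j))) := by
    rw [mul_assoc, hS.S_E, hπ, mul_smul_comm, ← mul_assoc, hKE, smul_mul_assoc, smul_smul,
      mul_assoc, hθ j i, hκs j i, mul_comm]
  have e3 : S (π i) * (K (root j) * S (π j)) = K (root j) * S (π j) * S (π i) := by
    rw [← mul_assoc, hS.S_K, mul_assoc, mul_assoc, S_comm]
  have key : comulE S K E π i * comulF S K F π j -
      θ i j • (comulF S K F π j * comulE S K E π i) =
      (K (root j) * S (π j) * S (π i)) ⊗ₜ (E i * F j - θ i j • (F j * E i)) +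
      (E i * F j - θ i j • (F j * E i)) ⊗ₜ K (-root i) := by
    simp only [comulE, comulF, mul_add, add_mul, Algebra.TensorProduct.tmul_mul_tmul, e1, e2, e3,
      hKF, mul_one, one_mul, TensorProduct.tmul_sub, TensorProduct.sub_tmul,
      ← TensorProduct.smul_tmul', TensorProduct.tmul_smul, smul_add, smul_smul]
    match_scalars
    · ring
    · ring
    · ring
    · linear_combination -(κ i j) * hθθ
    · ring
    · ring
  rw [key, hEF]
  split_ifs with hij
  · subst hij
    rw [mul_S_mul_S, comulK, comulK, TensorProduct.tmul_smul, ← TensorProduct.smul_tmul',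
      TensorProduct.tmul_sub, TensorProduct.sub_tmul, ← smul_add]
    congr 1
    abel
  · rw [TensorProduct.tmul_zero, TensorProduct.zero_tmul, add_zero]

end Comul

theorem exists_comulG (hn : 4 ≤ n) (ε : ZMod n → Fin 2) :
    ∃ Δ : UGenSig ε →ₐ[Kq] UGenSig ε ⊗[Kq] UGenSig ε, IsComulG ε Δ ∧
      ∀ g, Δ (gS ε g) = gS ε g ⊗ₜ gS ε g := by
  have h := genRep_UGenSig ε
  have hS := equivariant_UGenSig ε
  have hKE : ∀ i j, gK ε (-root i) * gE ε j =
      (bq ε (root i) (root j))⁻¹ • (gE ε j * gK ε (-root i)) := fun i j => by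
    rw [h.K_E, bq_neg]
  have hKF : ∀ i j, gK ε (-root i) * gF ε j =
      bq ε (root i) (root j) • (gF ε j * gK ε (-root i)) := fun i j => by
    rw [h.K_F, bq_neg, inv_inv]
  have hrep : GenRep ε (comulK (gK ε)) (comulE (gS ε) (gK ε) (gE ε) fun _ => 1)
      (comulF (gS ε) (gK ε) (gF ε) fun _ => 1) := by
    refine ⟨h.weight.comul, fun μ i => comulK_mul_comulE h.weight hS _ (h.K_E μ i),
      fun μ i => comulK_mul_comulF h.weight hS _ (h.K_F μ i), fun i j => ?_, ?_, ?_⟩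
    · have := comul_E_F (θ := fun _ _ => 1) (κ := fun i j => bq ε (root i) (root j))
        (d := fun _ => 1 / (q - q⁻¹)) hS (π := fun _ => 1) (fun i j => chik_one ε j)
        (fun _ _ => rfl) (fun _ _ => bq_comm ε _ _)
        (fun i j => h.K_E _ _) hKF (fun i j => by rw [one_smul, h.E_F]) i j
      rwa [one_smul] at this
    · have := h.serreE.comul hn (a := fun _ => 1) (b := fun i => gK ε (-root i))
        (α := fun _ _ => 1) (β := fun i j => (bq ε (root i) (root j))⁻¹)
        (fun _ _ => rfl) (fun _ _ => h.weight.comm _ _) (fun _ _ => by simp) hKE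
        (fun i j => by rw [bq_comm ε (root j), mul_inv_cancel₀ (bq_ne_zero ε _ _)])
      convert this using 2 with i
      rw [comulE, map_one]
    · have := h.serreF.comul' hn (a := fun _ => 1) (b := fun i => gK ε (root i))
        (α := fun _ _ => 1) (β := fun i j => (bq ε (root i) (root j))⁻¹)
        (fun _ _ => rfl) (fun _ _ => h.weight.comm _ _) (fun _ _ => by simp)
        (fun i j => h.K_F _ _)
        (fun i j => by rw [bq_comm ε (root j), mul_inv_cancel₀ (bq_ne_zero ε _ _)])
      convert this using 2 with i
      rw [comulF, map_one, mul_one]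
  obtain ⟨Δ, ΔK, ΔE, ΔF, ΔS⟩ := exists_hom_UGenSig hrep (hS.comul _)
  refine ⟨Δ, ⟨ΔK, fun j => ΔS _, fun i => ?_, fun i => ?_⟩, ΔS⟩
  · rw [ΔE, comulE, map_one]
  · rw [ΔF, comulF, map_one, mul_one]

/-! ### The comultiplication on the super side -/

theorem chi_sigAll (hn : 4 ≤ n) (ε : ZMod n → Fin 2) (i : ZMod n) :
    chi ε i (sigAll n) = (-1) ^ par ε i := by
  have h : ∀ j, sigAll n j = -1 := fun j => by
    rw [sigAll, Finset.prod_apply, Finset.prod_eq_single j]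
    · simp [sig]
    · intro k _ hk; simp [sig, Pi.mulSingle_eq_of_ne hk.symm]
    · simp
  rw [chi_apply hn, h, h, par, pow_add]

theorem chik_sigAll_pow (hn : 4 ≤ n) (ε : ZMod n → Fin 2) (i j : ZMod n) :
    chik ε (sigAll n ^ par ε i) j = (-1) ^ (par ε i * par ε j) := by
  rw [chik_eq_usign, map_pow, chi_sigAll hn, map_pow, usign_neg_one_pow, ← pow_mul, mul_comm]

/-- The scalar identity behind the exchange condition of `GenSerre.comul` for twisted generators.
Its left side equals χ_j(`twK ε i`), which is the ratio of 𝐪(α_i, α_j) and q^{(α_i|α_j)}. -/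
theorem TwistSign.chik_mul_chik (hn : 4 ≤ n) {ε : ZMod n → Fin 2} {w : ZMod n → Sig n}
    (hw : TwistSign ε w) {s : Wt n → Sig n} {c : Wt n → ℤˣ} (hsc : IsWeightTwist ε s c)
    (i j : ZMod n) : (-1) ^ (par ε i * par ε j) * chik ε (w i) j * chik ε (w j) i =
      bq ε (root i) (root j) * q ^ form ε (-root j) (root i) := by
  have h1 : (-1) ^ (par ε i * par ε j) * (chi ε j (w i) * chi ε i (w j)) =
      chi ε j (twK ε i) := by
    by_cases hij : i = j
    · subst hij
      rw [Int.units_mul_self, mul_one, chi_twK_self hn]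
      rcases Nat.even_or_odd (par ε i) with h | h
      · rw [h.neg_one_pow, (h.mul_right _).neg_one_pow]
      · rw [h.neg_one_pow, (h.mul h).neg_one_pow]
    · rw [hw i j hij, chi_twK_eq hn ε hij, ← mul_assoc, Int.units_mul_self, one_mul]
  have h2 := congrArg usign h1
  rw [map_mul, map_mul, usign_neg_one_pow, ← mul_assoc] at h2
  rw [chik_eq_usign, chik_eq_usign, h2, hsc.bq_eq, hsc.s_root, form_neg, form_comm ε (root j),
    zpow_neg, chik_eq_usign]
  have := zpow_ne_zero (form ε (root i) (root j)) q_ne_zero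
  field_simp

/-- The super Serre relations for the coproducts are not expanded. Multiplying Δ(E_i) by S(w_i) ⊗
S(w_i) yields a sum of the shape in `GenSerre.comul`, built from the twisted generators of U[σ],
which satisfy the relations of 𝒰. Twisting back in the tensor square gives the super relations. -/
theorem exists_comulS (hn : 4 ≤ n) {ε : ZMod n → Fin 2} (hε : ε 1 = 0) :
    ∃ Δ : USuperSig ε →ₐ[Kq] USuperSig ε ⊗[Kq] USuperSig ε, IsComulS ε Δ := by
  obtain ⟨s, c, hsc⟩ := exists_weight_twist hn ε
  have h := superRep_USuperSig ε
  have hS := equivariant_USuperSig ε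
  have hG := (genRep_twist_iff hn hε hsc hS).2 h
  have hSS : ∀ g g', sS ε g * sS ε g' = sS ε g' * sS ε g := S_comm _
  have hKF : ∀ i j, sK ε (-root i) * sF ε j =
      q ^ form ε (root i) (root j) • (sF ε j * sK ε (-root i)) := fun i j => by
    rw [h.K_F, form_neg, neg_neg]
  have hSX : ∀ {X : ZMod n → USuperSig ε} {w : ZMod n → Sig n},
      (∀ g i, sS ε g * X i = chik ε g i • (X i * sS ε g)) → ∀ g j,
      sS ε g * (X j * sS ε (w j)) = chik ε g j • (X j * sS ε (w j) * sS ε g) := by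
    intro X w hX g j
    rw [← mul_assoc, hX, smul_mul_assoc, mul_assoc, mul_assoc, hSS]
  have hKX : ∀ {X : ZMod n → USuperSig ε} {w : ZMod n → Sig n} {μ : Wt n} {j : ZMod n} {a : Kq}
      (g : Sig n), (∀ g i, sS ε g * X i = chik ε g i • (X i * sS ε g)) →
      sK ε μ * X j = a • (X j * sK ε μ) →
      sK ε μ * sS ε g * (X j * sS ε (w j)) =
        (a * chik ε g j) • (X j * sS ε (w j) * (sK ε μ * sS ε g)) := by
    intro X w μ j a g hX hK
    rw [mul_assoc, hSX hX, mul_smul_comm, ← mul_assoc, ← mul_assoc, hK, smul_mul_assoc,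
      smul_mul_assoc, smul_smul, mul_comm (chik ε g j), mul_assoc (X j), ← hS.S_K]
    simp only [mul_assoc]
  have hKS : ∀ μ ν g g', sK ε μ * sS ε g * (sK ε ν * sS ε g') =
      sK ε ν * sS ε g' * (sK ε μ * sS ε g) := by
    intro μ ν g g'
    have h1 : ∀ μ g, Commute (sK ε μ) (sS ε g) := fun μ g => (hS.S_K g μ).symm
    have h2 : Commute (sK ε μ) (sK ε ν) := h.weight.comm μ ν
    have h3 : Commute (sS ε g) (sS ε g') := hSS g g'
    exact ((h2.mul_left (h1 ν g).symm).mul_right ((h1 μ g').mul_left h3)).eq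
  have hΔ := hS.comul fun i => sigAll n ^ par ε i
  have hrep : SuperRep ε (comulK (sK ε))
      (comulE (sS ε) (sK ε) (sE ε) fun i => sigAll n ^ par ε i)
      (comulF (sS ε) (sK ε) (sF ε) fun i => sigAll n ^ par ε i) := by
    refine ⟨h.weight.comul, fun μ i => comulK_mul_comulE h.weight hS _ (h.K_E μ i),
      fun μ i => comulK_mul_comulF h.weight hS _ (h.K_F μ i), fun i j => ?_, ?_, ?_⟩
    · exact comul_E_F (θ := fun i j => (-1) ^ (par ε i * par ε j))
        (κ := fun i j => q ^ form ε (root i) (root j))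
        (d := fun i => (-1) ^ (ε i : ℕ) / (q - q⁻¹)) hS (chik_sigAll_pow hn ε)
        (fun _ _ => by rw [mul_comm])
        (fun _ _ => by rw [form_comm]) (fun i j => h.K_E _ _) hKF h.E_F i j
    · have h1 := hG.serreE.comul hn (a := fun i => sS ε (sigAll n ^ par ε i * twE ε i))
        (b := fun i => sK ε (-root i) * sS ε (twE ε i))
        (α := fun i j => (-1) ^ (par ε i * par ε j) * chik ε (twE ε i) j)
        (β := fun i j => q ^ form ε (-root i) (root j) * chik ε (twE ε i) j)
        (fun _ _ => hSS _ _) (fun _ _ => hKS _ _ _ _)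
        (fun i j => by rw [hSX hS.S_E, chik_mul, chik_sigAll_pow hn])
        (fun i j => hKX _ hS.S_E (h.K_E _ _))
        (fun i j => by
          rw [← mul_assoc, ← (twistSign_twE hn hε).chik_mul_chik hn hsc, mul_assoc,
            mul_assoc, chik_mul_self, mul_one])
      have h2 : GenSerre ε fun i => comulE (sS ε) (sK ε) (sE ε) (fun i => sigAll n ^ par ε i) i *
          comulS (sS ε) (twE ε i) := by
        convert h1 using 2 with i
        change (_ + _) * sS ε (twE ε i) ⊗ₜ[Kq] sS ε (twE ε i) = _
        simp only [add_mul, Algebra.TensorProduct.tmul_mul_tmul, map_mul]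
      -- The family in `h2` is already twisted; twisting it once more returns the coproducts of the
      -- E_i.
      have h3 := (superSerre_twist_iff hn (hΔ.twist (s := s) (c := c) (twE ε) (twF ε)).S_E
        (twistSign_twE hn hε)).2 h2
      simpa only [mul_S_mul_S] using h3
    · have h1 := hG.serreF.comul' hn (a := fun i => sS ε (twF ε i))
        (b := fun i => sK ε (root i) * sS ε (sigAll n ^ par ε i * twF ε i))
        (α := fun i j => chik ε (twF ε i) j)
        (β := fun i j => q ^ (-form ε (root i) (root j)) *
          ((-1) ^ (par ε i * par ε j) * chik ε (twF ε i) j))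
        (fun _ _ => hSS _ _) (fun _ _ => hKS _ _ _ _)
        (fun i j => hSX hS.S_F _ _)
        (fun i j => by rw [hKX _ hS.S_F (h.K_F _ _), chik_mul, chik_sigAll_pow hn])
        (fun i j => by
          rw [← form_neg, ← mul_assoc, ← (twistSign_twF hn hε).chik_mul_chik hn hsc,
            mul_comm (par ε j)]
          have h4 := chik_mul_self ε (twF ε j) i
          have h5 : ((-1 : Kq) ^ (par ε i * par ε j)) * (-1) ^ (par ε i * par ε j) = 1 := by
            rw [← mul_pow]; simp
          linear_combination -(chik ε (twF ε i) j) * h4 - chik ε (twF ε i) j *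
            (chik ε (twF ε j) i) ^ 2 * h5)
      have h2 : GenSerre ε fun i => comulF (sS ε) (sK ε) (sF ε) (fun i => sigAll n ^ par ε i) i *
          comulS (sS ε) (twF ε i) := by
        convert h1 using 2 with i
        change (_ + _) * sS ε (twF ε i) ⊗ₜ[Kq] sS ε (twF ε i) = _
        simp only [add_mul, Algebra.TensorProduct.tmul_mul_tmul, map_mul, one_mul, mul_assoc]
      have h3 := (superSerre_twist_iff hn (hΔ.twist (s := s) (c := c) (twE ε) (twF ε)).S_F
        (twistSign_twF hn hε)).2 h2
      simpa only [mul_S_mul_S] using h3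
  obtain ⟨Δ, ΔK, ΔE, ΔF, ΔS⟩ := exists_hom_USuperSig hrep hΔ
  exact ⟨Δ, ⟨ΔK, fun j => ΔS _, ΔE, ΔF⟩⟩

end QSuper

end

theorem mainTheorem12 (n : ℕ) [NeZero n] (hn : 4 ≤ n) (ε : ZMod n → Fin 2)
    (hM : QSuper.numZero ε ≠ 0) (hN : QSuper.numOne ε ≠ 0) (hε : ε 1 = 0) :
    ∃ τ : QSuper.subX ε ≃ₐ[QSuper.Kq] QSuper.subY ε,
      (∀ i : ZMod n, (τ (QSuper.xE ε i) : QSuper.UGenSig ε) = QSuper.tauE ε i) ∧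
      (∀ i : ZMod n, (τ (QSuper.xF ε i) : QSuper.UGenSig ε) = QSuper.tauF ε i) ∧
      (∀ i : ZMod n, (τ (QSuper.xK ε i) : QSuper.UGenSig ε) = QSuper.tauK ε i) ∧
      (∀ j : ZMod n, (τ (QSuper.xS ε j) : QSuper.UGenSig ε) = QSuper.gS ε (QSuper.sig j)) ∧
      (τ (QSuper.xLam ε) : QSuper.UGenSig ε) = QSuper.gK ε (QSuper.Lam n) ∧
      ∃ ΔS : QSuper.USuperSig ε →ₐ[QSuper.Kq]
          TensorProduct QSuper.Kq (QSuper.USuperSig ε) (QSuper.USuperSig ε),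
        ∃ ΔG : QSuper.UGenSig ε →ₐ[QSuper.Kq]
            TensorProduct QSuper.Kq (QSuper.UGenSig ε) (QSuper.UGenSig ε),
          QSuper.IsComulS ε ΔS ∧ QSuper.IsComulG ε ΔG ∧ ¬ QSuper.PreservesComul ε τ ΔS ΔG := by
  obtain ⟨τ, hE, hF, hK, hS, hL⟩ := QSuper.exists_tau hn hε
  obtain ⟨ΔS, hΔS⟩ := QSuper.exists_comulS hn hε
  obtain ⟨ΔG, hΔG, hgS⟩ := QSuper.exists_comulG hn ε
  exact ⟨τ, hE, hF, hK, hS, hL, ΔS, ΔG, hΔS, hΔG,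
    QSuper.not_preservesComul hN hε hK hΔS hΔG hgS⟩
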